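/- Let $\mathbb K$ be an algebraically closed field of characteristic $0$, let $p\in\mathbb K[x,y]$ be irreducible with $p\notin\mathbb K[x]\cup\mathbb K[y]$, and let $\mathbb K[x,y]_p$ be the ring of rational functions in $\mathbb K(x,y)$ whose reduced denominator is not divisible by $p$. Let $r\in\mathbb K[x,y]_p$, $f\in\mathbb K(x)$ and $g\in\mathbb K(y)$ be such that $r+qp=f-g$ for some $q\in\mathbb K[x,y]_p$. For $h\in\mathbb K(z)\setminus\{0\}$ and $s\in\mathbb P^1(\mathbb K)=\mathbb K\cup\{\infty\}$ let $\mathrm m(s,h)$ be the negative of the order of vanishing of $h$ at $s$ (so $\mathrm m(\infty,h)=\deg h$); $s$ is a pole of $h$ if $\mathrm m(s,h)>0$, and $\mathrm m(s,h)$ is then its multiplicity. The function $0$ has no poles. The curve associated with $p$ is the zero set $C\subset\mathbb P^1(\mathbb K)\times\mathbb P^1(\mathbb K)$ of the bi-homogenization $x_0^{\deg_x p}y_0^{\deg_y p}p(x_1/x_0,y_1/y_0)$. For a pair $T$ of Möbius transformations of the two factors of $\mathbb P^1(\mathbb K)\times\mathbb P^1(\mathbb K)$ let $p_T$ be the numerator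 of $p\circ T^{-1}$ and $r_T=r\circ T^{-1}$. Let $\mathbb K\{\{x^{-1}\}\}$ be the field of Puiseux series in $x^{-1}$ over $\mathbb K$, and let $\deg$ be the largest exponent of such a series as a series in $x$, with $\deg 0=-\infty$. For a point $(s_1,s_2)$, a branch at $(s_1,s_2)$ is a pair $(T,\varphi)$ of such a $T$ with $T(s_1,s_2)=(\infty,\infty)$ and a $\varphi\in\mathbb K\{\{x^{-1}\}\}$ with $p_T(x,\varphi)=0$ and $\deg\varphi>0$. The point $(s_1,s_2)$ is a pole of $r$ if $\deg r_T(x,\varphi)>0$ for some branch $(T,\varphi)$ at $(s_1,s_2)$. Let $(s_1,s_2)\in C$. Then for every $T$ with $T(s_1,s_2)=(\infty,\infty)$ there is a branch $(T,\varphi)$ at $(s_1,s_2)$, and the following hold. 1. If $(s_1,s_2)$ is a pole of $r$, then $s_1$ is a pole of $f$ or $s_2$ is a pole of $g$. 2. If $s_1$ is a pole of $f$ but $s_2$ is not a pole of $g$, then $\mathrm m(s_1,f)=\deg r_T(x,\varphi)$ for every branch $(T,\varphi)$ at $(s_1,s_2)$. If $s_2$ is a pole of $g$ but $s_1$ is not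 a pole of $f$, then $\mathrm m(s_2,g)=\deg r_T(x,\varphi)/\deg\varphi$ for every branch $(T,\varphi)$ at $(s_1,s_2)$. 3. If $(s_1,s_2)$ is not a pole of $r$, then $s_1$ is a pole of $f$ if and only if $s_2$ is a pole of $g$. 4. If $(s_1,s_2)$ is not a pole of $r$, and $s_1$ and $s_2$ are poles of $f$ and $g$, respectively, then $\mathrm m(s_2,g)=\mathrm m(s_1,f)/\deg\varphi$ for every branch $(T,\varphi)$ at $(s_1,s_2)$. -/

import Mathlib

open OnePoint

namespace SepCurve

noncomputable section

/-- `K[x, y]`, with `x` and `y` the variables of index `0` and `1`. -/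
abbrev Poly2 (K : Type*) [Field K] : Type _ := MvPolynomial (Fin 2) K

/-- `K(x, y)`. -/
abbrev Rat2 (K : Type*) [Field K] : Type _ := FractionRing (Poly2 K)

/-- Numerator of a rational function in reduced form. -/
def num {K : Type*} [Field K] (r : Rat2 K) : Poly2 K := IsFractionRing.num (Poly2 K) r

/-- Denominator of a rational function in reduced form. -/
def den {K : Type*} [Field K] (r : Rat2 K) : Poly2 K := (IsFractionRing.den (Poly2 K) r : Poly2 K)

/-- The element `x` of `K(x, y)`. -/
def xx (K : Type*) [Field K] : Rat2 K := algebraMap (Poly2 K) (Rat2 K) (MvPolynomial.X 0)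

/-- The element `y` of `K(x, y)`. -/
def yy (K : Type*) [Field K] : Rat2 K := algebraMap (Poly2 K) (Rat2 K) (MvPolynomial.X 1)

/-- The local ring `K[x, y]_p`: rational functions whose denominator is not divisible by `p`. -/
def InLocalRing {K : Type*} [Field K] (p : Poly2 K) (r : Rat2 K) : Prop := ¬ p ∣ den r

/-- The set `F(r, p)` of all pairs `(f, g)` in `K(x) × K(y)` such that `f - g = r + q p` for some
`q` in the local ring `K[x, y]_p`. -/
def sepSet {K : Type*} [Field K] (r : Rat2 K) (p : Poly2 K) : Set (RatFunc K × RatFunc K) :=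
  {fg | ∃ q : Rat2 K, InLocalRing p q ∧
    r + q * algebraMap (Poly2 K) (Rat2 K) p =
      RatFunc.eval (algebraMap K (Rat2 K)) (xx K) fg.1 -
        RatFunc.eval (algebraMap K (Rat2 K)) (yy K) fg.2}

/-- The value `m(s, f)`: minus the valuation of `f` at the point `s` of the projective line, so
the pole order at a finite point (negative at a zero) and the degree at infinity.
(The zero function, whose value should be `-∞`, gets `0`; only positive values matter below.) -/
def mult {K : Type*} [Field K] (s : OnePoint K) (f : RatFunc K) : ℤ :=
  s.elim f.intDegree
    (fun a => (f.denom.rootMultiplicity a : ℤ) - (f.num.rootMultiplicity a : ℤ))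

/-- `s` is a pole of the univariate rational function `f`. -/
def IsPole {K : Type*} [Field K] (s : OnePoint K) (f : RatFunc K) : Prop := 0 < mult s f

/-- Homogeneous coordinates `(s₀, s₁)` of a point of the projective line: `(1, s)` if the point `s`
is finite and `(0, 1)` if it is infinite. -/
def homCoord {K : Type*} [Field K] (s : OnePoint K) : K × K := s.elim (0, 1) (fun a => (1, a))

/-- The value at `((x₀, x₁), (y₀, y₁))` of the bi-homogenization
`x₀ ^ deg_x p * y₀ ^ deg_y p * p (x₁ / x₀, y₁ / y₀)` of `p`. -/
def biHom {K : Type*} [Field K] (p : Poly2 K) (x y : K × K) : K :=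
  ∑ m ∈ p.support, p.coeff m *
    (x.1 ^ (p.degreeOf 0 - m 0) * x.2 ^ m 0) * (y.1 ^ (p.degreeOf 1 - m 1) * y.2 ^ m 1)

/-- `(s₁, s₂)` lies on the curve in `ℙ¹ × ℙ¹` associated with `p`. -/
def OnCurve {K : Type*} [Field K] (p : Poly2 K) (s₁ s₂ : OnePoint K) : Prop :=
  biHom p (homCoord s₁) (homCoord s₂) = 0

/-- The value of a rational function `r` in two variables at a pair `(a, b)` of elements of an
extension field. -/
def evalRat {K : Type*} [Field K] {L : Type*} [Field L] [Algebra K L] (a b : L) (r : Rat2 K) : L :=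
  MvPolynomial.aeval ![a, b] (num r) / MvPolynomial.aeval ![a, b] (den r)

/-- The Möbius transformation with matrix `A`, applied to an element of an extension field. -/
def moebius {K : Type*} [Field K] {L : Type*} [Field L] [Algebra K L] (A : GL (Fin 2) K) (z : L) :
    L :=
  (algebraMap K L (A 0 0) * z + algebraMap K L (A 0 1)) /
    (algebraMap K L (A 1 0) * z + algebraMap K L (A 1 1))

/-- `r ∘ T⁻¹`, where `T` acts on the first coordinate by the Möbius transformation with matrix `A`
and on the second coordinate by that with matrix `B`. -/
def transRat {K : Type*} [Field K] (A B : GL (Fin 2) K) (r : Rat2 K) : Rat2 K :=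
  evalRat (moebius A⁻¹ (xx K)) (moebius B⁻¹ (yy K)) r

/-- The numerator of `p ∘ T⁻¹`, for `T` as in `transRat`. -/
def transPoly {K : Type*} [Field K] (A B : GL (Fin 2) K) (p : Poly2 K) : Poly2 K :=
  num (MvPolynomial.aeval ![moebius A⁻¹ (xx K), moebius B⁻¹ (yy K)] p)

/-- A Puiseux series in (positive powers of) `t`: a Hahn series with rational exponents that have
a common denominator. Here `t` stands for `x⁻¹`; Puiseux series form a subfield of the field
`HahnSeries ℚ K`, in which all computations take place. -/
def IsPuiseux {K : Type*} [Field K] (φ : HahnSeries ℚ K) : Prop :=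
  ∃ n : ℕ, 0 < n ∧ ∀ a ∈ φ.support, ∃ m : ℤ, a * n = m

/-- The series `x = t⁻¹`. -/
def xSer (K : Type*) [Field K] : HahnSeries ℚ K := HahnSeries.single (-1) 1

/-- The degree in `x = t⁻¹` of a series in `t`, that is, its largest exponent as a series in `x`.
(The zero series, whose degree should be `-∞`, gets `0`; only positive values matter below.) -/
def degSer {K : Type*} [Field K] (φ : HahnSeries ℚ K) : ℚ := -φ.order

/-- `φ` is a Puiseux series in `x⁻¹` with `p(x, φ) = 0` and `deg φ > 0`: a branch at `(∞, ∞)` of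
the curve associated with `p`. -/
def IsBranch {K : Type*} [Field K] (p : Poly2 K) (φ : HahnSeries ℚ K) : Prop :=
  IsPuiseux φ ∧ MvPolynomial.aeval ![xSer K, φ] p = 0 ∧ 0 < degSer φ

/-- `(∞, ∞)` is a pole of `r` on the curve associated with `p`. -/
def IsPoleAtInfty {K : Type*} [Field K] (p : Poly2 K) (r : Rat2 K) : Prop :=
  ∃ φ : HahnSeries ℚ K, IsBranch p φ ∧ 0 < degSer (evalRat (xSer K) φ r)

/-- `(s₁, s₂)` is a pole of `r` on the curve associated with `p`: some transformation `T` of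
`ℙ¹ × ℙ¹` maps `(s₁, s₂)` to `(∞, ∞)`, and the latter is a pole of `r ∘ T⁻¹` on the curve
associated with the numerator of `p ∘ T⁻¹`. -/
def IsPoleOnCurve {K : Type*} [Field K] [DecidableEq K] (p : Poly2 K) (r : Rat2 K)
    (s₁ s₂ : OnePoint K) : Prop :=
  ∃ A B : GL (Fin 2) K, A • s₁ = ∞ ∧ B • s₂ = ∞ ∧
    IsPoleAtInfty (transPoly A B p) (transRat A B r)

end

end SepCurve

open SepCurve

/-! Along a branch `(T, φ)` let `(a, b)` be the preimage of `(x, φ)` under `T`. It lies on `p = 0`,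
and `b` is transcendental over `K`, so it is a generic point of the curve: by Gauss's lemma and a
Bézout identity, no polynomial prime to `p` vanishes there. Hence `r + q p = f - g` can be evaluated
at `(a, b)`; the term `q p` drops out, which leaves `r_T(x, φ) = f(a) - g(b)`
(`evalRat_branch_eq_sub`).

Expanding `f` and `g` at `s₁` and `s₂` shows that the two terms have degrees `m(s₁, f)` and `m(s₂,
g) · deg φ` (`degSer_eval_moebius`). All claims about multiplicities now follow from the ultrametric
rule: a difference of series of distinct degrees has the larger degree, as long as that degree is
positive.

Existence of a branch (`exists_branch`) is the Newton-Puiseux theorem in local parameters at the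
point. Irreducibility and the dependence of `p` on both variables keep the curve from containing a
horizontal or vertical line, so the local equation has a root of finite multiplicity, and the series
found is nonzero and can be inverted to give `φ`. -/

namespace SepCurve

/-! ### The Newton-Puiseux theorem over power series -/

section NewtonPuiseux

open Polynomial
open scoped PowerSeries

/-- Hensel's lemma for a simple root at `0` of a polynomial over `K⟦X⟧` that need not be monic. -/
theorem exists_root_of_simple_root {K : Type*} [Field K] (G : Polynomial K⟦X⟧)
    (h0 : PowerSeries.constantCoeff (G.coeff 0) = 0) (h1 : PowerSeries.constantCoeff (G.coeff 1) ≠ 0) :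
    ∃ w : K⟦X⟧, PowerSeries.constantCoeff w = 0 ∧ G.eval w = 0 := by
  obtain ⟨e, he⟩ : ∃ e, G.natDegree = e + 1 := by
    refine ⟨G.natDegree - 1, (Nat.succ_pred_eq_of_pos ?_).symm⟩
    exact le_natDegree_of_ne_zero (fun h => h1 (by rw [h, map_zero]))
  set g := G.coeff 0 with hg
  set c := PowerSeries.constantCoeff (G.coeff 1) with hc
  -- The substitution `w = g / u` gives `u ^ (e + 1) * G(g / u) = g * H(u)` with `H = X ^ (e + 1) +
  -- Q` monic. Its reduction `X ^ e * (X + c)` has the simple root `-c ≠ 0`, which lifts to a unit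
  -- `u`.
  set Q : Polynomial K⟦X⟧ :=
    ∑ i ∈ Finset.range (e + 1), C (G.coeff (i + 1) * g ^ i) * Polynomial.X ^ (e - i) with hQ
  have hQdeg : Q.degree < ((e + 1 : ℕ) : WithBot ℕ) := by
    rw [← mem_degreeLT]
    refine Submodule.sum_mem _ fun i _ => mem_degreeLT.mpr ?_
    refine (degree_C_mul_X_pow_le _ _).trans_lt ?_
    exact_mod_cast (by omega : e - i < e + 1)
  set H : Polynomial K⟦X⟧ := Polynomial.X ^ (e + 1) + Q with hH
  have hHm : H.Monic := monic_X_pow_add hQdeg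
  have hmap : H.map PowerSeries.constantCoeff = Polynomial.X ^ e * (Polynomial.X + C c) := by
    have : Q.map PowerSeries.constantCoeff = Polynomial.X ^ e * C c := by
      rw [hQ, Polynomial.map_sum, Finset.sum_eq_single 0]
      · simp only [zero_add, pow_zero, mul_one, Nat.sub_zero, Polynomial.map_mul, map_C,
          Polynomial.map_pow, map_X, ← hc]
        ring
      · intro i _ hi
        simp [h0, hi]
      · simp
    rw [hH, Polynomial.map_add, this]
    simp; ring
  have hev : ∀ (F : Polynomial K⟦X⟧) (a : K⟦X⟧),
      PowerSeries.constantCoeff (F.eval a) = (F.map PowerSeries.constantCoeff).eval (PowerSeries.constantCoeff a) := by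
    intro F a
    rw [Polynomial.eval_map, Polynomial.eval₂_at_apply]
  obtain ⟨u, hu, hu'⟩ := HenselianRing.is_henselian (I := Ideal.span {(PowerSeries.X : K⟦X⟧)})
    H hHm (PowerSeries.C (-c)) (by
      rw [Ideal.mem_span_singleton, PowerSeries.X_dvd_iff, hev, hmap]
      simp) (by
      refine IsUnit.map _ ?_
      rw [PowerSeries.isUnit_iff_constantCoeff, hev, ← Polynomial.derivative_map, hmap]
      simpa [Polynomial.derivative_mul] using fun h => absurd h h1)
  have huc : PowerSeries.constantCoeff u ≠ 0 := by
    rw [Ideal.mem_span_singleton, PowerSeries.X_dvd_iff, map_sub, sub_eq_zero] at hu'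
    rw [hu']
    simpa using h1
  refine ⟨g * u⁻¹, by simp [h0], ?_⟩
  have huu : u⁻¹ * u = 1 := PowerSeries.inv_mul_cancel u huc
  have hu0 : u ≠ 0 := fun h => huc (by rw [h, map_zero])
  have key : G.eval (g * u⁻¹) * u ^ (e + 1) = g * H.eval u := by
    rw [Polynomial.eval_eq_sum_range, he, Finset.sum_range_succ', hH, Polynomial.eval_add, hQ,
      Polynomial.eval_finsetSum, add_mul, mul_add, Finset.sum_mul, Finset.mul_sum, add_comm]
    congr 1
    · simp [hg]
    · refine Finset.sum_congr rfl fun i hi => ?_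
      have hi' : i ≤ e := by simpa [Nat.lt_succ_iff] using hi
      obtain ⟨k, rfl⟩ := Nat.exists_eq_add_of_le hi'
      have : (u⁻¹) ^ (i + 1) * u ^ (i + 1) = 1 := by rw [← mul_pow, huu, one_pow]
      simp only [eval_mul, eval_C, eval_pow, eval_X, Nat.add_sub_cancel_left]
      calc _ = G.coeff (i + 1) * g ^ (i + 1) * u ^ k * ((u⁻¹) ^ (i + 1) * u ^ (i + 1)) := by ring
        _ = _ := by rw [this]; ring
  rw [show H.eval u = 0 from hu, mul_zero] at key
  exact (mul_eq_zero.mp key).resolve_right (pow_ne_zero _ hu0)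

theorem constantCoeff_coeff_taylor {K : Type*} [Field K] (F : Polynomial K⟦X⟧) (w : K⟦X⟧)
    (i : ℕ) : PowerSeries.constantCoeff ((taylor w F).coeff i) =
      (taylor (PowerSeries.constantCoeff w) (F.map PowerSeries.constantCoeff)).coeff i := by
  rw [← Polynomial.map_taylor, Polynomial.coeff_map]

/-- A translation that kills the coefficient of index `m`, where the coefficient of index `m + 1`
is a unit. -/
theorem exists_taylor_coeff_eq_zero {K : Type*} [Field K] [CharZero K] (F : Polynomial K⟦X⟧)
    (m : ℕ) (h0 : PowerSeries.constantCoeff (F.coeff m) = 0) (h1 : PowerSeries.constantCoeff (F.coeff (m + 1)) ≠ 0) :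
    ∃ w : K⟦X⟧, PowerSeries.constantCoeff w = 0 ∧ (taylor w F).coeff m = 0 := by
  -- The coefficient is the `m`-th Hasse derivative of `F` at `w`, a polynomial in `w` whose linear
  -- coefficient is `(m + 1) * F.coeff (m + 1)`, a unit in characteristic `0`.
  simp_rw [taylor_coeff]
  apply exists_root_of_simple_root
  · simp [hasseDeriv_coeff, h0]
  · rw [hasseDeriv_coeff, map_mul, map_natCast, add_comm 1 m]
    refine mul_ne_zero ?_ h1
    simpa using Nat.cast_add_one_ne_zero m

/-- A polynomial of degree `m` without a term of degree `m - 1` that is not a monomial has a root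
of multiplicity less than `m`. -/
theorem exists_taylor_order_lt {K : Type*} [Field K] [IsAlgClosed K] [CharZero K]
    (h : Polynomial K) (m : ℕ) (hdeg : h.natDegree = m + 1) (hm : h.coeff m = 0)
    (hi : ∃ i < m + 1, h.coeff i ≠ 0) :
    ∃ c : K, ∃ k, 0 < k ∧ k < m + 1 ∧ (∀ i < k, (taylor c h).coeff i = 0) ∧
      (taylor c h).coeff k ≠ 0 := by
  have hh : h ≠ 0 := by rintro rfl; simp at hdeg
  obtain ⟨c, hc⟩ := IsAlgClosed.exists_root h (by
    rw [degree_eq_natDegree hh, hdeg]; exact_mod_cast Nat.succ_ne_zero m)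
  obtain ⟨q, hq, hqc⟩ := exists_eq_pow_rootMultiplicity_mul_and_not_dvd h hh c
  set k := rootMultiplicity c h with hk
  have hq0 : q ≠ 0 := by rintro rfl; exact hqc (dvd_zero _)
  have ht : taylor c h = Polynomial.X ^ k * taylor c q := by
    rw [hq, taylor_mul, taylor_pow]; simp
  have hnat : m + 1 = k + q.natDegree := by
    rw [← hdeg, hq, natDegree_mul (pow_ne_zero _ (X_sub_C_ne_zero c)) hq0]; simp
  refine ⟨c, k, (rootMultiplicity_pos hh).mpr hc, ?_, ?_, ?_⟩
  -- Full multiplicity means `h = a (X - c) ^ (m + 1)`; the vanishing coefficient `-(m + 1) a c`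
  -- forces `c = 0`, so `h` would be a monomial.
  · by_contra hlt
    have hkm : k = m + 1 := by omega
    obtain ⟨a, ha⟩ := natDegree_eq_zero.mp (by omega : q.natDegree = 0)
    rw [← ha, hkm, sub_eq_add_neg, ← C_neg] at hq
    have ha0 : a ≠ 0 := by rintro rfl; simp at ha; exact hq0 ha.symm
    have h2 := hm
    rw [hq, coeff_mul_C, coeff_X_add_C_pow] at h2
    have hc0 : c = 0 := by
      simpa [ha0, Nat.cast_add_one_ne_zero, Nat.choose_succ_self_right] using h2
    obtain ⟨i, hi1, hi2⟩ := hi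
    apply hi2
    rw [hq, hc0]
    simp [coeff_X_pow, hi1.ne]
  · intro i hik
    rw [ht, coeff_X_pow_mul', if_neg (by omega)]
  · rw [ht, coeff_X_pow_mul', if_pos le_rfl, Nat.sub_self, taylor_coeff_zero]
    rwa [dvd_iff_isRoot] at hqc

/-- The least slope of the Newton polygon, with denominators cleared by ramification. -/
theorem exists_expand_eq_X_pow_mul {K : Type*} [Field K] (a : ℕ → K⟦X⟧) (m : ℕ) (hm : 0 < m)
    (ha : ∀ i < m, PowerSeries.constantCoeff (a i) = 0) (ha0 : a 0 ≠ 0) :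
    ∃ (M : ℕ) (hM : M ≠ 0) (k : ℕ) (c : ℕ → K⟦X⟧), 0 < k ∧
      (∀ i < m, PowerSeries.expand M hM (a i) = PowerSeries.X ^ (k * (m - i)) * c i) ∧
      ∃ i < m, PowerSeries.constantCoeff (c i) ≠ 0 := by
  classical
  set o : ℕ → ℕ := fun i => (a i).order.toNat with ho
  obtain ⟨j, hj, hjmin⟩ := Finset.exists_min_image
    ((Finset.range m).filter (fun i => a i ≠ 0)) (fun i => (o i : ℚ) / ((m - i : ℕ) : ℚ))
    ⟨0, by simp [hm, ha0]⟩
  simp only [Finset.mem_filter, Finset.mem_range] at hj hjmin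
  obtain ⟨hjm, hj0⟩ := hj
  have hoj : 0 < o j := by
    rcases Nat.eq_zero_or_pos (o j) with h | h
    · exfalso
      have h2 : PowerSeries.constantCoeff (PowerSeries.divXPowOrder (a j)) ≠ 0 :=
        fun h => hj0 (PowerSeries.constantCoeff_divXPowOrder_eq_zero_iff.mp h)
      rw [PowerSeries.constantCoeff_divXPowOrder] at h2
      simp only [ho] at h
      rw [h, PowerSeries.coeff_zero_eq_constantCoeff_apply, ha j hjm] at h2
      exact h2 rfl
    · exact h
  have hM : m - j ≠ 0 := by omega
  have hex : ∀ i, PowerSeries.expand (m - j) hM (a i) =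
      PowerSeries.X ^ ((m - j) * o i) * PowerSeries.expand (m - j) hM (PowerSeries.divXPowOrder (a i)) := by
    intro i
    conv_lhs => rw [← PowerSeries.X_pow_order_mul_divXPowOrder (f := a i)]
    rw [map_mul, map_pow, PowerSeries.expand_X, ← pow_mul]
  -- The least slope is `o j / (m - j)`; ramification of index `m - j` turns it into the integer `o
  -- j`, and the coefficient of index `j` then attains the bound.
  refine ⟨m - j, hM, o j, fun i => PowerSeries.X ^ ((m - j) * o i - o j * (m - i)) *
    PowerSeries.expand (m - j) hM (PowerSeries.divXPowOrder (a i)), hoj, ?_, j, hjm, ?_⟩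
  · intro i hi
    by_cases hai : a i = 0
    · simp [hai]
    · have h1 := hjmin i ⟨hi, hai⟩
      rw [div_le_div_iff₀ (by exact_mod_cast (by omega : 0 < m - j))
        (by exact_mod_cast (by omega : 0 < m - i))] at h1
      have h2 : o j * (m - i) ≤ (m - j) * o i := by
        rw [mul_comm (m - j)]; exact_mod_cast h1
      rw [hex, ← mul_assoc, ← pow_add, Nat.add_sub_cancel' h2]
  · have h2 : PowerSeries.constantCoeff (PowerSeries.divXPowOrder (a j)) ≠ 0 :=
        fun h => hj0 (PowerSeries.constantCoeff_divXPowOrder_eq_zero_iff.mp h)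
    dsimp only
    rw [mul_comm (m - j), Nat.sub_self, pow_zero, one_mul, PowerSeries.constantCoeff_expand]
    exact h2

theorem eval_map_expand {K : Type*} [Field K] (N : ℕ) (hN : N ≠ 0) (F : Polynomial K⟦X⟧)
    (w : K⟦X⟧) : (F.map (PowerSeries.expand N hN : K⟦X⟧ →ₐ[K] K⟦X⟧).toRingHom).eval (PowerSeries.expand N hN w) =
      PowerSeries.expand N hN (F.eval w) := by
  rw [Polynomial.eval_map]
  exact Polynomial.eval₂_at_apply (PowerSeries.expand N hN : K⟦X⟧ →ₐ[K] K⟦X⟧).toRingHom w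

/-- The Newton-Puiseux theorem: after ramification, a polynomial over `K⟦X⟧` whose reduction has a
root at `0` of finite positive multiplicity has a root in the maximal ideal. -/
theorem newton_puiseux {K : Type*} [Field K] [IsAlgClosed K] [CharZero K] (m : ℕ) :
    ∀ F : Polynomial K⟦X⟧, 0 < m → (∀ i < m, PowerSeries.constantCoeff (F.coeff i) = 0) →
      PowerSeries.constantCoeff (F.coeff m) ≠ 0 →
      ∃ (N : ℕ) (hN : N ≠ 0) (w : K⟦X⟧), PowerSeries.constantCoeff w = 0 ∧
        (F.map (PowerSeries.expand N hN : K⟦X⟧ →ₐ[K] K⟦X⟧).toRingHom).eval w = 0 := by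
  induction m using Nat.strong_induction_on with
  | _ m ih =>
  intro F hm h0 h1
  obtain ⟨m, rfl⟩ : ∃ n, m = n + 1 := ⟨m - 1, by omega⟩
  -- Tschirnhaus translation. Either `w₀` is itself a root, or rescaling the unknown along the least
  -- slope gives `F₁`, whose reduction `h` has degree `m + 1`, no term of degree `m`, and is not a
  -- monomial. A root of `h` then has smaller multiplicity and the induction applies.
  obtain ⟨w₀, hw₀, hw₀m⟩ := exists_taylor_coeff_eq_zero F m (h0 m (by omega)) h1
  have hT : ∀ i, PowerSeries.constantCoeff ((taylor w₀ F).coeff i) = PowerSeries.constantCoeff (F.coeff i) := by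
    intro i
    rw [constantCoeff_coeff_taylor, hw₀, taylor_zero, Polynomial.coeff_map]
  by_cases hT0 : (taylor w₀ F).coeff 0 = 0
  · refine ⟨1, one_ne_zero, w₀, hw₀, ?_⟩
    rw [taylor_coeff_zero] at hT0
    have := eval_map_expand 1 one_ne_zero F w₀
    rw [hT0, map_zero, PowerSeries.expand_one_apply] at this
    exact this
  obtain ⟨M, hM, k, c, hk, hc, j, hj, hcj⟩ := exists_expand_eq_X_pow_mul
    (fun i => (taylor w₀ F).coeff i) (m + 1) hm (fun i hi => by rw [hT, h0 i hi]) hT0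
  set b : ℕ → K⟦X⟧ := fun i => PowerSeries.expand M hM ((taylor w₀ F).coeff i) with hb
  set n := (taylor w₀ F).natDegree with hn
  set d : ℕ → K⟦X⟧ := fun i =>
    if i < m + 1 then c i else PowerSeries.X ^ (k * (i - (m + 1))) * b i with hd
  have hdb : ∀ i, PowerSeries.X ^ (k * i) * b i = PowerSeries.X ^ (k * (m + 1)) * d i := by
    intro i
    by_cases hi : i < m + 1
    · simp only [hd, if_pos hi, hb]
      rw [hc i hi, ← mul_assoc, ← pow_add, ← mul_add, Nat.add_sub_cancel' hi.le]
    · simp only [hd, if_neg hi]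
      rw [← mul_assoc, ← pow_add, ← mul_add, Nat.add_sub_cancel' (by omega)]
  set F₁ : Polynomial K⟦X⟧ := ∑ i ∈ Finset.range (n + 1), Polynomial.monomial i (d i) with hF₁
  have hbn : ∀ i, n < i → b i = 0 := fun i hi => by
    simp only [hb]; rw [coeff_eq_zero_of_natDegree_lt hi, map_zero]
  have hdn : ∀ i, n < i → d i = 0 := by
    intro i hi
    have := hdb i
    rw [hbn i hi, mul_zero] at this
    exact (mul_eq_zero.mp this.symm).resolve_left (pow_ne_zero _ PowerSeries.X_ne_zero)
  have hcoeff : ∀ i, F₁.coeff i = d i := by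
    intro i
    rw [hF₁, finsetSum_coeff]
    simp only [coeff_monomial, Finset.sum_ite_eq', Finset.mem_range]
    split_ifs with hi
    · rfl
    · exact (hdn i (by omega)).symm
  have hcomp : ((taylor w₀ F).map (PowerSeries.expand M hM : K⟦X⟧ →ₐ[K] K⟦X⟧).toRingHom).comp
      (C (PowerSeries.X ^ k) * Polynomial.X) = C (PowerSeries.X ^ (k * (m + 1))) * F₁ := by
    rw [comp_eq_sum_left, sum_over_range' _ (by simp) (n + 1)
      (Nat.lt_succ_of_le natDegree_map_le), hF₁, Finset.mul_sum]
    refine Finset.sum_congr rfl fun i _ => ?_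
    rw [C_mul_monomial, ← hdb, mul_pow, ← C_pow, ← pow_mul, ← mul_assoc, ← C_mul,
      C_mul_X_pow_eq_monomial, coeff_map, mul_comm (PowerSeries.X ^ _)]
    rfl
  set h := F₁.map PowerSeries.constantCoeff with hh
  have hhc : ∀ i, h.coeff i = PowerSeries.constantCoeff (d i) := fun i => by rw [hh, coeff_map, hcoeff]
  have hhm : h.coeff (m + 1) ≠ 0 := by
    rw [hhc]
    simp only [hd, lt_irrefl, if_false, Nat.sub_self, mul_zero, pow_zero, one_mul, hb]
    rwa [PowerSeries.constantCoeff_expand, hT]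
  have hhdeg : h.natDegree = m + 1 := by
    refine le_antisymm (natDegree_le_iff_coeff_eq_zero.mpr fun i hi => ?_)
      (le_natDegree_of_ne_zero hhm)
    rw [hhc]
    simp only [hd, if_neg (by omega : ¬ i < m + 1)]
    -- As `k > 0`, rescaling leaves a positive power of the parameter in the coefficients beyond `m
    -- + 1`.
    have : k * (i - (m + 1)) ≠ 0 := mul_ne_zero hk.ne' (by omega)
    simp [this]
  have hhm' : h.coeff m = 0 := by
    rw [hhc]
    have := hc m (by omega)
    simp only [hw₀m, map_zero] at this
    have := (mul_eq_zero.mp this.symm).resolve_left (pow_ne_zero _ PowerSeries.X_ne_zero)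
    simp only [hd, if_pos (by omega : m < m + 1), this, map_zero]
  obtain ⟨r, l, hl0, hlm, hl, hl'⟩ := exists_taylor_order_lt h m hhdeg hhm'
    ⟨j, hj, by rw [hhc]; simpa only [hd, if_pos hj] using hcj⟩
  obtain ⟨N, hN, w, hw, hroot⟩ := ih l hlm (taylor (PowerSeries.C r) F₁) hl0
    (fun i hi => by
      rw [constantCoeff_coeff_taylor, PowerSeries.constantCoeff_C]; exact hl i hi)
    (by rw [constantCoeff_coeff_taylor, PowerSeries.constantCoeff_C]; exact hl')
  have hMN : (PowerSeries.expand N hN : K⟦X⟧ →ₐ[K] K⟦X⟧).toRingHom.comp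
      (PowerSeries.expand M hM : K⟦X⟧ →ₐ[K] K⟦X⟧).toRingHom =
        (PowerSeries.expand (N * M) (N.mul_ne_zero hN hM) : K⟦X⟧ →ₐ[K] K⟦X⟧).toRingHom := by
    ext1 x
    exact (PowerSeries.expand_mul N hN M hM x).symm
  set E := (PowerSeries.expand N hN : K⟦X⟧ →ₐ[K] K⟦X⟧).toRingHom with hE
  have hEX : E PowerSeries.X = PowerSeries.X ^ N := PowerSeries.expand_X N hN
  have hEC : E (PowerSeries.C r) = PowerSeries.C r := PowerSeries.expand_C N hN r
  rw [Polynomial.map_taylor, taylor_eval, hEC] at hroot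
  have := congrArg (fun P => (P.map E).eval (w + PowerSeries.C r)) hcomp
  simp only [Polynomial.map_comp, Polynomial.map_mul, eval_mul, eval_comp, hroot, mul_zero,
    Polynomial.map_map, hMN, Polynomial.map_X, eval_X, map_pow] at this
  rw [Polynomial.map_taylor, taylor_eval] at this
  -- Undoing the substitutions, the root is `E (X ^ k) * (w + r)` plus the ramified `w₀`; its
  -- constant term vanishes because `k` and `N` are positive.
  refine ⟨N * M, N.mul_ne_zero hN hM, _, ?_, this⟩
  have h2 : PowerSeries.constantCoeff
      (PowerSeries.expand (N * M) (N.mul_ne_zero hN hM) w₀) = 0 := by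
    rw [PowerSeries.constantCoeff_expand, hw₀]
  rw [map_add]
  refine (congrArg₂ (· + ·) ?_ h2).trans (add_zero 0)
  simp [hEX, hk.ne', hN]

end NewtonPuiseux

/-! ### Values of rational functions at points over an extension field -/

section HasValue

variable {K : Type*} [Field K] {L : Type*} [Field L] [Algebra K L]

/-- The rational function `r` is regular at `(a, b)`, with value `v`. -/
def HasValue (a b : L) (r : Rat2 K) (v : L) : Prop :=
  ∃ N D : Poly2 K, MvPolynomial.aeval ![a, b] D ≠ 0 ∧
    r * algebraMap (Poly2 K) (Rat2 K) D = algebraMap (Poly2 K) (Rat2 K) N ∧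
    v * MvPolynomial.aeval ![a, b] D = MvPolynomial.aeval ![a, b] N

variable {a b : L} {r s : Rat2 K} {v w : L}

theorem HasValue.of_poly (a b : L) (P : Poly2 K) :
    HasValue a b (algebraMap (Poly2 K) (Rat2 K) P) (MvPolynomial.aeval ![a, b] P) :=
  ⟨P, 1, by simp, by simp, by simp⟩

theorem HasValue.of_const (a b : L) (c : K) :
    HasValue a b (algebraMap K (Rat2 K) c) (algebraMap K L c) := by
  have := HasValue.of_poly a b (MvPolynomial.C c)
  rwa [MvPolynomial.aeval_C, ← MvPolynomial.algebraMap_eq,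
    ← IsScalarTower.algebraMap_apply] at this

theorem HasValue.of_xx (a b : L) : HasValue a b (xx K) a := by
  simpa [xx] using HasValue.of_poly a b (MvPolynomial.X (0 : Fin 2) : Poly2 K)

theorem HasValue.of_yy (a b : L) : HasValue a b (yy K) b := by
  simpa [yy] using HasValue.of_poly a b (MvPolynomial.X (1 : Fin 2) : Poly2 K)

theorem HasValue.add (hr : HasValue a b r v) (hs : HasValue a b s w) :
    HasValue a b (r + s) (v + w) := by
  obtain ⟨N, D, hD, h1, h2⟩ := hr
  obtain ⟨N', D', hD', h1', h2'⟩ := hs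
  refine ⟨N * D' + N' * D, D * D', by simp [hD, hD'], ?_, ?_⟩
  · simp only [map_add, map_mul, ← h1, ← h1']; ring
  · simp only [map_add, map_mul, ← h2, ← h2']; ring

theorem HasValue.mul (hr : HasValue a b r v) (hs : HasValue a b s w) :
    HasValue a b (r * s) (v * w) := by
  obtain ⟨N, D, hD, h1, h2⟩ := hr
  obtain ⟨N', D', hD', h1', h2'⟩ := hs
  refine ⟨N * N', D * D', by simp [hD, hD'], ?_, ?_⟩
  · simp only [map_mul, ← h1, ← h1']; ring
  · simp only [map_mul, ← h2, ← h2']; ring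

theorem HasValue.sub (hr : HasValue a b r v) (hs : HasValue a b s w) :
    HasValue a b (r - s) (v - w) := by
  have := hr.add ((HasValue.of_const a b (-1)).mul hs)
  simpa [sub_eq_add_neg] using this

theorem HasValue.inv (hr : HasValue a b r v) (hv : v ≠ 0) : HasValue a b r⁻¹ v⁻¹ := by
  obtain ⟨N, D, hD, h1, h2⟩ := hr
  have hN : MvPolynomial.aeval ![a, b] N ≠ 0 := by rw [← h2]; exact mul_ne_zero hv hD
  have hr0 : r ≠ 0 := by
    rintro rfl
    rw [zero_mul] at h1
    have : N = 0 := (FaithfulSMul.algebraMap_injective (Poly2 K) (Rat2 K)) (by rw [← h1, map_zero])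
    exact hN (by rw [this, map_zero])
  exact ⟨D, N, hN, by rw [← h1, inv_mul_cancel_left₀ hr0], by rw [← h2, inv_mul_cancel_left₀ hv]⟩

theorem HasValue.div (hr : HasValue a b r v) (hs : HasValue a b s w) (hw : w ≠ 0) :
    HasValue a b (r / s) (v / w) := by
  simpa only [div_eq_mul_inv] using hr.mul (hs.inv hw)

theorem num_div_den (r : Rat2 K) :
    algebraMap (Poly2 K) (Rat2 K) (num r) / algebraMap (Poly2 K) (Rat2 K) (den r) = r :=
  IsFractionRing.mk'_num_den' (Poly2 K) r

theorem algebraMap_den_ne_zero (r : Rat2 K) : algebraMap (Poly2 K) (Rat2 K) (den r) ≠ 0 := by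
  intro h
  have := (FaithfulSMul.algebraMap_injective (Poly2 K) (Rat2 K)) (h.trans (map_zero _).symm)
  exact nonZeroDivisors.ne_zero (IsFractionRing.den (Poly2 K) r).2 this

/-- A fraction `N / D` for `r` need not be reduced, but `den r` is coprime to `num r` and therefore
divides `D`. This ties `HasValue`, which is stable under field operations, to `evalRat`, which uses
the reduced form. -/
theorem HasValue.den_ne_zero (hr : HasValue a b r v) :
    MvPolynomial.aeval ![a, b] (den r) ≠ 0 := by
  obtain ⟨N, D, hD, h1, -⟩ := hr
  have h3 : num r * D = den r * N := by
    apply FaithfulSMul.algebraMap_injective (Poly2 K) (Rat2 K)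
    have h0 := (div_eq_iff (algebraMap_den_ne_zero r)).mp (num_div_den r)
    rw [map_mul, map_mul, ← h1, h0]
    ring
  have h4 : den r ∣ D :=
    (IsFractionRing.num_den_reduced (Poly2 K) r).symm.dvd_of_dvd_mul_left ⟨N, h3⟩
  obtain ⟨c, rfl⟩ := h4
  rw [map_mul] at hD
  exact left_ne_zero_of_mul hD

theorem HasValue.of_den_ne_zero (h : MvPolynomial.aeval ![a, b] (den r) ≠ 0) :
    HasValue a b r (evalRat a b r) := by
  have := (HasValue.of_poly a b (num r)).div (HasValue.of_poly a b (den r)) h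
  rwa [num_div_den] at this

theorem HasValue.unique (h : HasValue a b r v) (h' : HasValue a b r w) : v = w := by
  obtain ⟨N, D, hD, h1, h2⟩ := h
  obtain ⟨N', D', hD', h1', h2'⟩ := h'
  have h3 : N * D' = N' * D := by
    apply FaithfulSMul.algebraMap_injective (Poly2 K) (Rat2 K)
    rw [map_mul, map_mul, ← h1, ← h1']; ring
  have h4 := congrArg (MvPolynomial.aeval ![a, b]) h3
  rw [map_mul, map_mul, ← h2, ← h2'] at h4
  have h5 : (v - w) * (MvPolynomial.aeval ![a, b] D * MvPolynomial.aeval ![a, b] D') = 0 := by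
    linear_combination h4
  exact sub_eq_zero.mp ((mul_eq_zero.mp h5).resolve_right (mul_ne_zero hD hD'))

theorem HasValue.evalRat_eq (h : HasValue a b r v) : evalRat a b r = v :=
  (HasValue.of_den_ne_zero h.den_ne_zero).unique h

theorem HasValue.mvAeval (hr : HasValue a b r v) (hs : HasValue a b s w) (P : Poly2 K) :
    HasValue a b (MvPolynomial.aeval ![r, s] P) (MvPolynomial.aeval ![v, w] P) := by
  induction P using MvPolynomial.induction_on with
  | C c =>
    rw [MvPolynomial.aeval_C, MvPolynomial.aeval_C]
    exact HasValue.of_const a b c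
  | add p q hp hq => rw [map_add, map_add]; exact hp.add hq
  | mul_X p i hp =>
    rw [map_mul, map_mul, MvPolynomial.aeval_X, MvPolynomial.aeval_X]
    refine hp.mul ?_
    fin_cases i
    · exact hr
    · exact hs

theorem HasValue.polyAeval (hr : HasValue a b r v) (P : Polynomial K) :
    HasValue a b (Polynomial.aeval r P) (Polynomial.aeval v P) := by
  induction P using Polynomial.induction_on' with
  | add p q hp hq => rw [map_add, map_add]; exact hp.add hq
  | monomial n c =>
    rw [Polynomial.aeval_monomial, Polynomial.aeval_monomial]
    refine (HasValue.of_const a b c).mul ?_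
    induction n with
    | zero => simpa using HasValue.of_const (K := K) a b 1
    | succ n ih => rw [pow_succ, pow_succ]; exact ih.mul hr

/-- Compatibility of evaluation with substitution; it computes `transRat` along a branch. -/
theorem HasValue.evalRat (hr : HasValue a b r v) (hs : HasValue a b s w) (q : Rat2 K)
    (hq : MvPolynomial.aeval ![v, w] (den q) ≠ 0) :
    HasValue a b (evalRat r s q) (SepCurve.evalRat v w q) :=
  (hr.mvAeval hs (num q)).div (hr.mvAeval hs (den q)) hq

theorem HasValue.moebius (hr : HasValue a b r v) (A : GL (Fin 2) K)
    (h : algebraMap K L (A 1 0) * v + algebraMap K L (A 1 1) ≠ 0) :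
    HasValue a b (moebius A r) (SepCurve.moebius A v) :=
  (((HasValue.of_const a b _).mul hr).add (HasValue.of_const a b _)).div
    (((HasValue.of_const a b _).mul hr).add (HasValue.of_const a b _)) h

theorem HasValue.ratFuncEval {K L : Type*} [Field K] [Field L] [Algebra K L] {a b v : L}
    {r : Rat2 K} (hr : HasValue a b r v) (f : RatFunc K)
    (h : Polynomial.aeval v f.denom ≠ 0) :
    HasValue a b (RatFunc.eval (algebraMap K (Rat2 K)) r f)
      (Polynomial.aeval v f.num / Polynomial.aeval v f.denom) :=
  (hr.polyAeval f.num).div (hr.polyAeval f.denom) h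

end HasValue

/-! ### Generic points of the curve -/

section Nonvanishing

/-- Passing to polynomials in `x` over `K[y]` puts the evaluation in the form where Gauss's lemma
applies. -/
theorem aeval_eq_eval₂_finSuccEquiv {K : Type*} [Field K] {L : Type*} [Field L] [Algebra K L]
    (a b : L) (P : Poly2 K) : MvPolynomial.aeval ![a, b] P =
      Polynomial.eval₂ (MvPolynomial.aeval (fun _ : Fin 1 => b) : MvPolynomial (Fin 1) K →ₐ[K] L)
        a (MvPolynomial.finSuccEquiv K 1 P) := by
  induction P using MvPolynomial.induction_on with
  | C c => simp [MvPolynomial.finSuccEquiv_apply]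
  | add p q hp hq => rw [map_add, map_add, hp, hq, Polynomial.eval₂_add]
  | mul_X p i hp =>
    rw [map_mul, map_mul, hp, Polynomial.eval₂_mul]
    congr 1
    fin_cases i
    · simp [MvPolynomial.finSuccEquiv_apply]
    · have := MvPolynomial.finSuccEquiv_X_succ (R := K) (j := (0 : Fin 1))
      rw [Fin.succ_zero_eq_one] at this
      simp [this]

/-- By Gauss's lemma `p` stays irreducible, and still does not divide `d`, over the fraction field
of `R`. There `u p + v d = 1`, and a common zero of `p` and `d` would give `0 = 1`. -/
theorem eval₂_ne_zero_of_not_dvd {R L : Type*} [CommRing R] [IsDomain R] [IsGCDMonoid R] [Field L]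
    {φ : R →+* L} (hφ : Function.Injective φ) {p d : Polynomial R} (hp : Irreducible p)
    (hdeg : p.natDegree ≠ 0) {a : L} (hpa : p.eval₂ φ a = 0) (hd : ¬ p ∣ d) :
    d.eval₂ φ a ≠ 0 := by
  intro hda
  have hprim : p.IsPrimitive := hp.isPrimitive hdeg
  have hirr := (hprim.irreducible_iff_irreducible_map_fraction_map (K := FractionRing R)).mp hp
  have hcop := hirr.coprime_iff_not_dvd.mpr fun h => hd
    (hprim.dvd_of_fraction_map_dvd_fraction_map (q := d) h)
  obtain ⟨u, v, huv⟩ := hcop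
  have h1 := congrArg (Polynomial.eval₂ (IsFractionRing.lift hφ) a) huv
  have h2 : (IsFractionRing.lift hφ : FractionRing R →+* L).comp (algebraMap R (FractionRing R)) =
      φ := RingHom.ext fun x => IsFractionRing.lift_algebraMap hφ x
  rw [Polynomial.eval₂_add, Polynomial.eval₂_mul, Polynomial.eval₂_mul, Polynomial.eval₂_map,
    Polynomial.eval₂_map, h2, Polynomial.eval₂_one, hpa, hda, mul_zero, mul_zero, add_zero] at h1
  exact zero_ne_one h1

/-- A polynomial that is not divisible by `p` does not vanish at a generic point of the curve
`p = 0`. -/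
theorem aeval_ne_zero_of_not_dvd {K : Type*} [Field K] {L : Type*} [Field L] [Algebra K L]
    {p d : Poly2 K} (hp : Irreducible p) (hpx : 0 < p.degreeOf 0) {a b : L}
    (hb : Transcendental K b) (hpab : MvPolynomial.aeval ![a, b] p = 0) (hd : ¬ p ∣ d) :
    MvPolynomial.aeval ![a, b] d ≠ 0 := by
  rw [aeval_eq_eval₂_finSuccEquiv] at hpab ⊢
  refine eval₂_ne_zero_of_not_dvd ?_ ((MulEquiv.irreducible_iff _).mpr hp) ?_ hpab
    fun h => hd ((map_dvd_iff (MvPolynomial.finSuccEquiv K 1)).mp h)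
  · exact (algebraicIndependent_unique_type_iff (x := fun _ : Fin 1 => b)).mpr hb
  · rw [MvPolynomial.natDegree_finSuccEquiv]; exact hpx.ne'

end Nonvanishing

/-! ### Orders of univariate functions along a series of positive degree -/

section Order

open Polynomial

variable {K : Type*} [Field K]

theorem algebraMap_hahnSeries (c : K) : algebraMap K (HahnSeries ℚ K) c = HahnSeries.C c := by
  rw [HahnSeries.algebraMap_apply']
  exact HahnSeries.ofPowerSeries_C c

theorem order_algebraMap (c : K) : (algebraMap K (HahnSeries ℚ K) c).order = 0 := by
  rw [algebraMap_hahnSeries, HahnSeries.order_C]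

/-- A negative order excludes `x = 0`, since the zero series has order `0` by convention; the case
`y = 0` is harmless. -/
theorem order_add_eq_left {x y : HahnSeries ℚ K} (hx : x.order < 0) (hy : x.order < y.order) :
    x + y ≠ 0 ∧ (x + y).order = x.order := by
  have hx0 : x ≠ 0 := by rintro rfl; simp at hx
  have h : x.orderTop < y.orderTop := by
    rw [← HahnSeries.order_eq_orderTop_of_ne_zero hx0]
    rcases eq_or_ne y 0 with rfl | hy0
    · rw [HahnSeries.orderTop_zero]; exact WithTop.coe_lt_top _
    · rw [← HahnSeries.order_eq_orderTop_of_ne_zero hy0]; exact WithTop.coe_lt_coe.mpr hy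
  have h2 := HahnSeries.orderTop_add_eq_left h
  have h3 : x + y ≠ 0 := by
    rw [← HahnSeries.orderTop_ne_top, h2, HahnSeries.orderTop_ne_top]; exact hx0
  refine ⟨h3, ?_⟩
  rw [← HahnSeries.order_eq_orderTop_of_ne_zero hx0,
    ← HahnSeries.order_eq_orderTop_of_ne_zero h3] at h2
  exact_mod_cast h2

theorem order_inv {x : HahnSeries ℚ K} (hx : x ≠ 0) : x⁻¹.order = -x.order := by
  have := HahnSeries.order_mul hx (inv_ne_zero hx)
  rw [mul_inv_cancel₀ hx, HahnSeries.order_one] at this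
  linarith

theorem order_div {x y : HahnSeries ℚ K} (hx : x ≠ 0) (hy : y ≠ 0) :
    (x / y).order = x.order - y.order := by
  rw [div_eq_mul_inv, HahnSeries.order_mul hx (inv_ne_zero hy), order_inv hy, sub_eq_add_neg]

/-- The leading term dominates because `z` has positive degree; the induction is Horner's scheme. -/
theorem order_aeval {z : HahnSeries ℚ K} (hz : z.order < 0) (n : ℕ) (P : K[X])
    (hn : P.natDegree = n) (hP : P ≠ 0) : aeval z P ≠ 0 ∧ (aeval z P).order = n * z.order := by
  have hz0 : z ≠ 0 := by rintro rfl; simp at hz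
  induction n generalizing P with
  | zero =>
    obtain ⟨c, rfl⟩ := natDegree_eq_zero.mp hn
    rw [aeval_C, order_algebraMap]
    exact ⟨by simpa using hP, by simp⟩
  | succ n ih =>
    have hQ : P.divX.natDegree = n := by rw [natDegree_divX_eq_natDegree_tsub_one, hn]; rfl
    have hQ0 : P.divX ≠ 0 := by
      intro h
      have := divX_mul_X_add P
      rw [h, zero_mul, zero_add] at this
      rw [← this, natDegree_C] at hn
      omega
    obtain ⟨h1, h2⟩ := ih _ hQ hQ0
    have h3 : (aeval z P.divX * z).order = (n + 1 : ℕ) * z.order := by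
      rw [HahnSeries.order_mul h1 hz0, h2]; push_cast; ring
    rw [← divX_mul_X_add P, map_add, map_mul, aeval_X, aeval_C, ← h3]
    have h4 : (aeval z P.divX * z).order < 0 := by
      rw [h3]; exact mul_neg_of_pos_of_neg (by positivity) hz
    exact order_add_eq_left h4 (by rwa [order_algebraMap])

/-- After Taylor expansion at `s`, the lowest term in `z⁻¹` decides, and its exponent is the root
multiplicity. Reversing the polynomial reduces this to the leading term in `z`. -/
theorem order_aeval_add_inv {z : HahnSeries ℚ K} (hz : z.order < 0) (s : K) (P : K[X])
    (hP : P ≠ 0) : aeval (algebraMap K _ s + z⁻¹) P ≠ 0 ∧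
      (aeval (algebraMap K _ s + z⁻¹) P).order = -(P.rootMultiplicity s : ℚ) * z.order := by
  have hz0 : z ≠ 0 := by rintro rfl; simp at hz
  set T := taylor s P with hT
  have hT0 : T ≠ 0 := by rwa [hT, Ne, taylor_eq_zero]
  have hTP : aeval (algebraMap K _ s + z⁻¹) P = aeval z⁻¹ T := by
    rw [hT, taylor_apply, aeval_comp]; simp [add_comm]
  let _ : Invertible z⁻¹ := invertibleOfNonzero (inv_ne_zero hz0)
  have hrev := eval₂_reverse_mul_pow (algebraMap K (HahnSeries ℚ K)) z⁻¹ T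
  rw [invOf_eq_inv, inv_inv] at hrev
  have hr0 : T.reverse ≠ 0 := by rwa [Ne, reverse_eq_zero]
  obtain ⟨h1, h2⟩ := order_aeval hz _ T.reverse rfl hr0
  have hpow : (z⁻¹) ^ T.natDegree ≠ 0 := pow_ne_zero _ (inv_ne_zero hz0)
  rw [hTP, aeval_def, ← hrev, ← aeval_def]
  refine ⟨mul_ne_zero h1 hpow, ?_⟩
  rw [HahnSeries.order_mul h1 hpow, h2, HahnSeries.order_pow, order_inv hz0, reverse_natDegree,
    rootMultiplicity_eq_natTrailingDegree, ← taylor_apply, ← hT,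
    Nat.cast_sub (natTrailingDegree_le_natDegree T)]
  simp only [nsmul_eq_mul]; ring

/-- Minus the valuation of a polynomial at a point of the projective line. -/
noncomputable def polyMult (s : OnePoint K) (P : K[X]) : ℤ :=
  s.elim (P.natDegree : ℤ) (fun a => -(P.rootMultiplicity a : ℤ))

theorem mult_eq_sub (s : OnePoint K) (f : RatFunc K) :
    mult s f = polyMult s f.num - polyMult s f.denom := by
  cases s with
  | infty => rfl
  | coe a => simp only [mult, polyMult, OnePoint.elim_some]; ring

variable [DecidableEq K]

theorem moebius_denom_ne_zero (A : GL (Fin 2) K) {z : HahnSeries ℚ K} (hz : z.order < 0) :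
    algebraMap K (HahnSeries ℚ K) (A 1 0) * z + algebraMap K _ (A 1 1) ≠ 0 ∧
    (algebraMap K (HahnSeries ℚ K) (A 1 0) * z + algebraMap K _ (A 1 1)).order =
      if A 1 0 = 0 then 0 else z.order := by
  have hdet := A.det_ne_zero
  rw [Matrix.det_fin_two] at hdet
  split_ifs with h
  · have h2 : A 1 1 ≠ 0 := by intro h'; simp [h, h'] at hdet
    rw [h, map_zero, zero_mul, zero_add]
    exact ⟨by simpa using h2, order_algebraMap _⟩
  · have h1 := order_aeval hz 1 (C (A 1 0) * X + C (A 1 1)) (natDegree_linear h)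
      (by intro h0; have := natDegree_linear (b := A 1 1) h; rw [h0] at this; simp at this)
    simpa using h1

/-- If `B` fixes `∞`, the transform is affine in `z` and keeps its order. Otherwise it equals `s +
y⁻¹` with `y` of the same order as `z`. -/
theorem order_aeval_moebius (B : GL (Fin 2) K) (s : OnePoint K) (hB : B • (∞ : OnePoint K) = s)
    {z : HahnSeries ℚ K} (hz : z.order < 0) (P : K[X]) (hP : P ≠ 0) :
    aeval (moebius B z) P ≠ 0 ∧ (aeval (moebius B z) P).order = polyMult s P * z.order := by
  have hdet := B.det_ne_zero
  rw [Matrix.det_fin_two] at hdet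
  have hz0 : z ≠ 0 := by rintro rfl; simp at hz
  obtain ⟨hd, hdo⟩ := moebius_denom_ne_zero B hz
  rw [smul_infty_eq_ite] at hB
  split_ifs at hB hdo with h
  · subst hB
    have h00 : B 0 0 ≠ 0 := by intro h'; simp [h, h'] at hdet
    have h11 : B 1 1 ≠ 0 := by intro h'; simp [h, h'] at hdet
    have hdeg := natDegree_linear (b := B 0 1 / B 1 1) (div_ne_zero h00 h11)
    have h1 := order_aeval hz 1 (C (B 0 0 / B 1 1) * X + C (B 0 1 / B 1 1)) hdeg
      (by intro h0; rw [h0] at hdeg; simp at hdeg)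
    have hm : moebius B z = aeval z (C (B 0 0 / B 1 1) * X + C (B 0 1 / B 1 1)) := by
      have : algebraMap K (HahnSeries ℚ K) (B 1 1) ≠ 0 := by simpa using h11
      simp only [moebius, h, map_zero, zero_mul, zero_add, map_add, map_mul, aeval_C, aeval_X,
        map_div₀]
      field_simp
    rw [← hm, Nat.cast_one, one_mul] at h1
    have h2 := order_aeval (z := moebius B z) (by rw [h1.2]; exact hz) _ P rfl hP
    rw [h1.2] at h2
    exact_mod_cast h2
  · subst hB
    -- With `B = (a, b; c, d)`, this comes from `(a z + b) / (c z + d) - a / c = -(a d - b c) / (c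
    -- (c z + d))`.
    set y := -(algebraMap K (HahnSeries ℚ K) (B 1 0) * (algebraMap K (HahnSeries ℚ K) (B 1 0) * z +
      algebraMap K _ (B 1 1))) / algebraMap K (HahnSeries ℚ K) (B 0 0 * B 1 1 - B 0 1 * B 1 0)
      with hy
    have hc : algebraMap K (HahnSeries ℚ K) (B 1 0) ≠ 0 := by simpa using h
    have hdet' : algebraMap K (HahnSeries ℚ K) (B 0 0 * B 1 1 - B 0 1 * B 1 0) ≠ 0 := by
      rw [Ne, map_eq_zero]; exact hdet
    have hyo : y.order = z.order := by
      rw [hy, order_div (neg_ne_zero.mpr (mul_ne_zero hc hd)) hdet', HahnSeries.order_neg,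
        HahnSeries.order_mul hc hd, hdo, order_algebraMap, order_algebraMap]
      ring
    have hm : moebius B z = algebraMap K _ (B 0 0 / B 1 0) + y⁻¹ := by
      rw [hy, moebius, inv_div, map_div₀]
      obtain ⟨D, hD⟩ : ∃ D, D = algebraMap K (HahnSeries ℚ K) (B 1 0) * z + algebraMap K _ (B 1 1) :=
        ⟨_, rfl⟩
      rw [← hD] at hd ⊢
      simp only [map_sub, map_mul]
      field_simp
      rw [hD]
      ring
    have h2 := order_aeval_add_inv (z := y) (by rw [hyo]; exact hz) (B 0 0 / B 1 0) P hP
    rw [← hm, hyo] at h2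
    refine ⟨h2.1, h2.2.trans ?_⟩
    simp [polyMult]

theorem transcendental_moebius (B : GL (Fin 2) K) {z : HahnSeries ℚ K} (hz : z.order < 0) :
    Transcendental K (moebius B z) := by
  rw [transcendental_iff]
  intro P h
  by_contra hP
  exact (order_aeval_moebius B _ rfl hz P hP).1 h

/-- The degree of `f` at a Puiseux parametrization of a neighbourhood of `s`. -/
theorem degSer_eval_moebius (B : GL (Fin 2) K) (s : OnePoint K) (hB : B • (∞ : OnePoint K) = s)
    {z : HahnSeries ℚ K} (hz : 0 < degSer z) (f : RatFunc K) :
    degSer (aeval (moebius B z) f.num / aeval (moebius B z) f.denom) = mult s f * degSer z := by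
  have hz' : z.order < 0 := by simpa [degSer] using hz
  -- For `f = 0` both sides are `0` by the default values of `mult` and `degSer`.
  by_cases hf : f = 0
  · subst hf
    have : mult s (0 : RatFunc K) = 0 := by
      rw [mult_eq_sub]
      cases s <;> simp [polyMult]
    simp [this, degSer]
  · obtain ⟨h1, h2⟩ := order_aeval_moebius B s hB hz' f.num (RatFunc.num_ne_zero hf)
    obtain ⟨h3, h4⟩ := order_aeval_moebius B s hB hz' f.denom (RatFunc.denom_ne_zero f)
    rw [degSer, order_div h1 h3, h2, h4, mult_eq_sub, degSer]
    push_cast; ring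

end Order

/-! ### The bi-homogenization and its restriction to lines -/

section BiHom

/-- The bi-homogenization of `p`, evaluated in a `K`-algebra. -/
noncomputable def biHomEval {K R : Type*} [Field K] [CommRing R] [Algebra K R] (p : Poly2 K)
    (x y : R × R) : R :=
  ∑ m ∈ p.support, algebraMap K R (p.coeff m) *
    (x.1 ^ (p.degreeOf 0 - m 0) * x.2 ^ m 0) * (y.1 ^ (p.degreeOf 1 - m 1) * y.2 ^ m 1)

variable {K : Type*} [Field K]

theorem map_biHomEval {R S : Type*} [CommRing R] [Algebra K R] [CommRing S] [Algebra K S]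
    (f : R →+* S) (hf : ∀ c, f (algebraMap K R c) = algebraMap K S c) (p : Poly2 K) (x y : R × R) :
    f (biHomEval p x y) = biHomEval p (f x.1, f x.2) (f y.1, f y.2) := by
  simp only [biHomEval, map_sum, map_mul, map_pow, hf]

theorem biHomEval_mul {R : Type*} [CommRing R] [Algebra K R] (p : Poly2 K) (c d x₀ x₁ y₀ y₁ : R) :
    biHomEval p (c * x₀, c * x₁) (d * y₀, d * y₁) =
      c ^ p.degreeOf 0 * d ^ p.degreeOf 1 * biHomEval p (x₀, x₁) (y₀, y₁) := by
  rw [biHomEval, biHomEval, Finset.mul_sum]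
  refine Finset.sum_congr rfl fun m hm => ?_
  obtain ⟨i, hi⟩ := Nat.exists_eq_add_of_le (MvPolynomial.monomial_le_degreeOf 0 hm)
  obtain ⟨j, hj⟩ := Nat.exists_eq_add_of_le (MvPolynomial.monomial_le_degreeOf 1 hm)
  simp only [hi, hj, Nat.add_sub_cancel_left]
  ring

theorem biHomEval_one {R : Type*} [CommRing R] [Algebra K R] (p : Poly2 K) (a b : R) :
    biHomEval p (1, a) (1, b) = MvPolynomial.aeval ![a, b] p := by
  rw [biHomEval, MvPolynomial.aeval_def, MvPolynomial.eval₂_eq']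
  simp [mul_assoc]

theorem biHomEval_div {L : Type*} [Field L] [Algebra K L] (p : Poly2 K) {x y : L × L}
    (hx : x.1 ≠ 0) (hy : y.1 ≠ 0) : biHomEval p x y =
      x.1 ^ p.degreeOf 0 * y.1 ^ p.degreeOf 1 *
        MvPolynomial.aeval ![x.2 / x.1, y.2 / y.1] p := by
  rw [← biHomEval_one, ← biHomEval_mul, mul_one, mul_one, mul_div_cancel₀ _ hx,
    mul_div_cancel₀ _ hy]

theorem dvd_sub_aeval {σ : Type*} (D : MvPolynomial σ K) (g : σ → MvPolynomial σ K)
    (h : ∀ i, D ∣ MvPolynomial.X i - g i) (P : MvPolynomial σ K) :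
    D ∣ P - MvPolynomial.aeval g P := by
  induction P using MvPolynomial.induction_on with
  | C c => simp
  | add p q hp hq =>
    rw [map_add, add_sub_add_comm]
    exact dvd_add hp hq
  | mul_X p i hp =>
    rw [map_mul, MvPolynomial.aeval_X]
    have : p * MvPolynomial.X i - MvPolynomial.aeval g p * g i =
        (p - MvPolynomial.aeval g p) * MvPolynomial.X i +
          MvPolynomial.aeval g p * (MvPolynomial.X i - g i) := by ring
    rw [this]
    exact dvd_add (hp.mul_right _) ((h i).mul_left _)

/-- The cofactor would be a unit, hence a constant, and `p` would not involve `y`. -/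
theorem not_X_sub_C_dvd {p : Poly2 K} (hp : Irreducible p) (hpy : 0 < p.degreeOf 1) (s : K) :
    ¬ (MvPolynomial.X 0 - MvPolynomial.C s : Poly2 K) ∣ p := by
  rintro ⟨u, hu⟩
  rcases hp.isUnit_or_isUnit hu with h | h
  · have h1 := h.map (MvPolynomial.aeval ![MvPolynomial.C s, MvPolynomial.X 1] :
      Poly2 K →ₐ[K] Poly2 K)
    rw [map_sub, MvPolynomial.aeval_X, MvPolynomial.aeval_C] at h1
    simp [MvPolynomial.algebraMap_eq] at h1
  · rw [MvPolynomial.isUnit_iff_eq_C_of_isReduced] at h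
    obtain ⟨c, -, rfl⟩ := h
    rw [hu] at hpy
    have h1 := MvPolynomial.degreeOf_mul_le (1 : Fin 2)
      (MvPolynomial.X 0 - MvPolynomial.C s : Poly2 K) (MvPolynomial.C c)
    have h2 := MvPolynomial.degreeOf_sub_le (1 : Fin 2)
      (MvPolynomial.X 0 : Poly2 K) (MvPolynomial.C s)
    rw [MvPolynomial.degreeOf_C] at h1 h2
    rw [MvPolynomial.degreeOf_X_of_ne (by decide)] at h2
    simp at h2
    omega

theorem aeval_aeval_C_X {S : Type*} [CommRing S] [Algebra K S] (p : Poly2 K) (s : K) (y : S) :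
    Polynomial.aeval y (MvPolynomial.aeval ![Polynomial.C s, Polynomial.X] p) =
      MvPolynomial.aeval ![algebraMap K S s, y] p := by
  rw [← AlgHom.comp_apply, MvPolynomial.comp_aeval]
  congr 2
  funext i
  fin_cases i <;> simp

/-- A zero at a transcendental `b` forces `p(s, y) = 0` identically, so that `x - s` divides `p`. -/
theorem aeval_ne_zero_of_transcendental {L : Type*} [Field L] [Algebra K L] {p : Poly2 K}
    (hp : Irreducible p) (hpy : 0 < p.degreeOf 1) (s : K) {b : L} (hb : Transcendental K b) :
    MvPolynomial.aeval ![algebraMap K L s, b] p ≠ 0 := by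
  intro h
  set q : Polynomial K := MvPolynomial.aeval ![Polynomial.C s, Polynomial.X] p with hq
  have hq0 : q = 0 := (transcendental_iff.mp hb) q (by rw [hq, aeval_aeval_C_X, h])
  refine not_X_sub_C_dvd hp hpy s ?_
  have h1 := dvd_sub_aeval (MvPolynomial.X 0 - MvPolynomial.C s : Poly2 K)
    ![MvPolynomial.C s, MvPolynomial.X 1] (fun i => by fin_cases i <;> simp) p
  have h2 := aeval_aeval_C_X p s (MvPolynomial.X 1 : Poly2 K)
  rw [← hq, hq0, map_zero, MvPolynomial.algebraMap_eq] at h2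
  rwa [← h2, sub_zero] at h1

/-- The restriction of the curve to a line `{s} × ℙ¹` does not vanish at a generic point. -/
theorem biHomEval_ne_zero {L : Type*} [Field L] [Algebra K L] {p : Poly2 K}
    (hp : Irreducible p) (hpy : 0 < p.degreeOf 1) {c d : K} (hcd : c ≠ 0 ∨ d ≠ 0) {y : L × L}
    (hy : y.1 ≠ 0) (hb : Transcendental K (y.2 / y.1)) :
    biHomEval p (algebraMap K L c, algebraMap K L d) y ≠ 0 := by
  by_cases hc : c = 0
  · subst hc
    have hd : d ≠ 0 := hcd.resolve_left (fun h => h rfl)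
    set n := p.degreeOf 0 with hn
    -- On the line at infinity the factor `0 ^ (n - m 0)` keeps only monomials of full degree `n` in
    -- `x`: `h` is `d ^ n` times the leading coefficient of `p` in `x`.
    set h : Polynomial K := ∑ m ∈ p.support, Polynomial.monomial (m 1)
      (p.coeff m * (0 ^ (n - m 0) * d ^ m 0)) with hh
    have hval : biHomEval p (algebraMap K L 0, algebraMap K L d) y =
        y.1 ^ p.degreeOf 1 * Polynomial.aeval (y.2 / y.1) h := by
      have h1 := biHomEval_mul p 1 y.1 (algebraMap K L 0) (algebraMap K L d) 1 (y.2 / y.1)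
      rw [one_mul, one_mul, mul_one, mul_div_cancel₀ _ hy, one_pow, one_mul] at h1
      rw [h1, hh, map_sum, biHomEval]
      congr 1
      refine Finset.sum_congr rfl fun m _ => ?_
      rw [Polynomial.aeval_monomial]
      simp [hn]
    rw [hval]
    refine mul_ne_zero (pow_ne_zero _ hy) fun h0 => ?_
    have hh0 := (transcendental_iff.mp hb) h h0
    obtain ⟨m, hm, hmn⟩ := Finset.exists_mem_eq_sup p.support
      (MvPolynomial.support_nonempty.mpr hp.ne_zero) (fun m => m 0)
    rw [← MvPolynomial.degreeOf_eq_sup] at hmn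
    have hcoeff := congrArg (fun P => Polynomial.coeff P (m 1)) hh0
    simp only [hh, Polynomial.finsetSum_coeff, Polynomial.coeff_monomial,
      Polynomial.coeff_zero] at hcoeff
    rw [Finset.sum_eq_single m] at hcoeff
    · have := MvPolynomial.mem_support_iff.mp hm
      simp [hn, hmn, hd, this] at hcoeff
    · intro m' hm' hne
      split_ifs with h1
      · have h2 := MvPolynomial.monomial_le_degreeOf 0 hm'
        have h3 : m' 0 ≠ n := by
          intro h3
          apply hne
          ext i
          fin_cases i
          · exact h3.trans hmn
          · exact h1
        rw [zero_pow (by omega)]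
        simp
      · rfl
    · exact fun h => absurd hm h
  · rw [biHomEval_div p (by simpa using hc) hy]
    refine mul_ne_zero (mul_ne_zero (pow_ne_zero _ (by simpa using hc)) (pow_ne_zero _ hy)) ?_
    simp only
    rw [← map_div₀]
    exact aeval_ne_zero_of_transcendental hp hpy _ hb

/-- `p` with its variables exchanged. -/
noncomputable def swapVars (p : Poly2 K) : Poly2 K := MvPolynomial.rename (Equiv.swap 0 1) p

theorem degreeOf_swapVars (p : Poly2 K) (i : Fin 2) :
    (swapVars p).degreeOf (Equiv.swap 0 1 i) = p.degreeOf i :=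
  MvPolynomial.degreeOf_rename_of_injective (Equiv.swap (0 : Fin 2) 1).injective i

theorem biHomEval_swapVars {R : Type*} [CommRing R] [Algebra K R] (p : Poly2 K) (x y : R × R) :
    biHomEval (swapVars p) y x = biHomEval p x y := by
  have h0 := degreeOf_swapVars p 0
  have h1 := degreeOf_swapVars p 1
  rw [Equiv.swap_apply_left] at h0
  rw [Equiv.swap_apply_right] at h1
  have hinj := (Equiv.swap (0 : Fin 2) 1).injective
  rw [biHomEval, biHomEval, h0, h1, swapVars, MvPolynomial.support_rename_of_injective hinj,
    Finset.sum_image (fun m _ m' _ h => Finsupp.mapDomain_injective hinj h)]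
  refine Finset.sum_congr rfl fun m _ => ?_
  have e0 : Finsupp.mapDomain (Equiv.swap (0 : Fin 2) 1) m 0 = m 1 := by
    exact Finsupp.mapDomain_apply hinj m 1
  have e1 : Finsupp.mapDomain (Equiv.swap (0 : Fin 2) 1) m 1 = m 0 := by
    exact Finsupp.mapDomain_apply hinj m 0
  rw [MvPolynomial.coeff_rename_mapDomain _ hinj, e0, e1]
  ring

theorem biHomEval_ne_zero' {L : Type*} [Field L] [Algebra K L] {p : Poly2 K}
    (hp : Irreducible p) (hpx : 0 < p.degreeOf 0) {c d : K} (hcd : c ≠ 0 ∨ d ≠ 0) {x : L × L}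
    (hx : x.1 ≠ 0) (ha : Transcendental K (x.2 / x.1)) :
    biHomEval p x (algebraMap K L c, algebraMap K L d) ≠ 0 := by
  rw [← biHomEval_swapVars]
  refine biHomEval_ne_zero ?_ ?_ hcd hx ha
  · exact (MulEquiv.irreducible_iff (MvPolynomial.renameEquiv K (Equiv.swap (0 : Fin 2) 1))).mpr hp
  · have h0 := degreeOf_swapVars p 0
    rw [Equiv.swap_apply_left] at h0
    rwa [h0]

end BiHom

/-! ### Existence of branches -/

section Branches

open scoped PowerSeries

variable {K : Type*} [Field K]

/-- Substitution of `t ^ (1 / N)` in a power series. -/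
theorem exists_substRoot (K : Type*) [Field K] (N : ℕ) (hN : N ≠ 0) :
    ∃ θ : K⟦X⟧ →+* HahnSeries ℚ K,
      (∀ c, θ (PowerSeries.C c) = algebraMap K (HahnSeries ℚ K) c) ∧
      θ PowerSeries.X = HahnSeries.single (1 / N : ℚ) 1 ∧
      (∀ v, ∀ a ∈ (θ v).support, ∃ n : ℕ, a = n / N) ∧
      ∀ v, PowerSeries.constantCoeff v ≠ 0 → (θ v).order = 0 := by
  have hN' : (0 : ℚ) < N := by exact_mod_cast Nat.pos_of_ne_zero hN
  set f : ℕ →+ ℚ := (AddMonoidHom.mulRight (1 / N : ℚ)).comp (Nat.castAddMonoidHom ℚ) with hf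
  have hfn : ∀ n, f n = n / N := fun n => by simp [hf, div_eq_mul_inv]
  have hfi : Function.Injective f := by
    intro a b h
    rw [hfn, hfn, div_left_inj' hN'.ne'] at h
    exact_mod_cast h
  have hfle : ∀ g g', f g ≤ f g' ↔ g ≤ g' := by
    intro a b
    rw [hfn, hfn, div_le_div_iff_of_pos_right hN']
    exact_mod_cast Iff.rfl
  set θ : K⟦X⟧ →+* HahnSeries ℚ K := (HahnSeries.embDomainRingHom f hfi hfle).comp
    (HahnSeries.toPowerSeries.symm : K⟦X⟧ ≃+* HahnSeries ℕ K).toRingHom with hθ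
  have hcoeff : ∀ (v : K⟦X⟧) (n : ℕ), (θ v).coeff (n / N) = PowerSeries.coeff n v := by
    intro v n
    rw [← hfn]
    exact (HahnSeries.embDomain_coeff (f := ⟨⟨f, hfi⟩, hfle _ _⟩)).trans
      HahnSeries.coeff_toPowerSeries_symm
  have hsupp : ∀ v, ∀ a ∈ (θ v).support, ∃ n : ℕ, a = n / N := by
    intro v a ha
    by_contra h
    push Not at h
    refine ha (HahnSeries.embDomain_of_notMem_range (f := ⟨⟨f, hfi⟩, hfle _ _⟩) ?_)
    rintro ⟨n, hn⟩
    exact h n (hn.symm.trans (hfn n))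
  have hext : ∀ (v : K⟦X⟧) (y : HahnSeries ℚ K), (∀ n : ℕ, y.coeff (n / N) = PowerSeries.coeff n v) →
      (∀ a ∈ y.support, ∃ n : ℕ, a = n / N) → θ v = y := by
    intro v y h1 h2
    ext a
    by_cases ha : ∃ n : ℕ, a = n / N
    · obtain ⟨n, rfl⟩ := ha
      rw [hcoeff, h1]
    · rw [Function.notMem_support.mp fun h => ha (hsupp v a h),
        Function.notMem_support.mp fun h => ha (h2 a h)]
  refine ⟨θ, fun c => ?_, ?_, hsupp, ?_⟩
  · rw [algebraMap_hahnSeries]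
    refine hext _ _ (fun n => ?_) fun a ha => ⟨0, ?_⟩
    · rw [PowerSeries.coeff_C, HahnSeries.C_apply, HahnSeries.coeff_single]
      simp [hN]
    · have := HahnSeries.support_single_subset ha
      simpa using this
  · refine hext _ _ (fun n => ?_) fun a ha => ⟨1, ?_⟩
    · rw [PowerSeries.coeff_X, HahnSeries.coeff_single, div_left_inj' hN'.ne']
      simp
    · have := HahnSeries.support_single_subset ha
      simpa using this
  · intro v hv
    have hc : (θ v).coeff 0 ≠ 0 := by
      have := hcoeff v 0
      rw [Nat.cast_zero, zero_div] at this
      rwa [this, PowerSeries.coeff_zero_eq_constantCoeff_apply]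
    have h0 : θ v ≠ 0 := HahnSeries.ne_zero_of_coeff_ne_zero hc
    have h1 : (θ v).orderTop = (0 : ℚ) := HahnSeries.orderTop_eq_of_le hc (by
      intro a ha
      obtain ⟨n, rfl⟩ := hsupp v a ha
      positivity)
    rw [← HahnSeries.order_eq_orderTop_of_ne_zero h0] at h1
    exact_mod_cast h1

theorem order_xSer : (xSer K).order = -1 := HahnSeries.order_single one_ne_zero

theorem degSer_xSer : degSer (xSer K) = 1 := by rw [degSer, order_xSer, neg_neg]

theorem xSer_inv : (xSer K)⁻¹ = HahnSeries.single 1 1 := by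
  rw [xSer, HahnSeries.inv_single]; simp

/-- In the local parameter `z⁻¹` at `∞`, numerator and denominator become the homogeneous
coordinates to which Newton-Puiseux is applied. -/
theorem moebius_eq_div_inv (B : GL (Fin 2) K) {z : HahnSeries ℚ K} (hz : z ≠ 0) :
    moebius B z = (algebraMap K _ (B 0 0) + algebraMap K _ (B 0 1) * z⁻¹) /
      (algebraMap K _ (B 1 0) + algebraMap K _ (B 1 1) * z⁻¹) := by
  rw [moebius, ← mul_div_mul_right _ _ (inv_ne_zero hz), add_mul, add_mul, mul_assoc, mul_assoc,
    mul_inv_cancel₀ hz, mul_one, mul_one]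

variable [DecidableEq K]

theorem denom_inv_ne_zero (B : GL (Fin 2) K) {z : HahnSeries ℚ K} (hz : z.order < 0) :
    algebraMap K (HahnSeries ℚ K) (B 1 0) + algebraMap K _ (B 1 1) * z⁻¹ ≠ 0 := by
  have hz0 : z ≠ 0 := by rintro rfl; simp at hz
  have := mul_ne_zero (moebius_denom_ne_zero B hz).1 (inv_ne_zero hz0)
  rwa [add_mul, mul_assoc, mul_inv_cancel₀ hz0, mul_one] at this

/-- The transformed `p` is regular at `(x, y)`, so its reduced denominator does not vanish there and
only the numerator matters. -/
theorem aeval_transPoly_eq_zero_iff (A B : GL (Fin 2) K) (p : Poly2 K) {x y : HahnSeries ℚ K}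
    (hx : x.order < 0) (hy : y.order < 0) :
    MvPolynomial.aeval ![x, y] (transPoly A B p) = 0 ↔
      MvPolynomial.aeval ![moebius A⁻¹ x, moebius B⁻¹ y] p = 0 := by
  have h := (((HasValue.of_xx x y).moebius A⁻¹ (moebius_denom_ne_zero A⁻¹ hx).1)).mvAeval
    ((HasValue.of_yy x y).moebius B⁻¹ (moebius_denom_ne_zero B⁻¹ hy).1) p
  rw [← h.evalRat_eq, evalRat, div_eq_zero_iff, or_iff_left h.den_ne_zero]
  rfl

/-- The first column of `B` represents the image of `∞`; it is read upwards because `homCoord` lists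
the homogenizing coordinate first. -/
theorem exists_mul_homCoord (B : GL (Fin 2) K) (s : OnePoint K) (hB : B • (∞ : OnePoint K) = s) :
    ∃ c : K, c ≠ 0 ∧ (B 1 0 = c * (homCoord s).1) ∧ B 0 0 = c * (homCoord s).2 := by
  have hdet := B.det_ne_zero
  rw [Matrix.det_fin_two] at hdet
  rw [smul_infty_eq_ite] at hB
  subst hB
  split_ifs with h
  · refine ⟨B 0 0, fun h' => by simp [h, h'] at hdet, ?_⟩
    simp [homCoord, h]
  · refine ⟨B 1 0, h, ?_⟩
    simp [homCoord, mul_div_cancel₀ _ h]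

theorem col_zero_ne_zero (B : GL (Fin 2) K) : B 1 0 ≠ 0 ∨ B 0 0 ≠ 0 := by
  by_contra! h
  have hdet := B.det_ne_zero
  simp [Matrix.det_fin_two, h.1, h.2] at hdet

theorem biHom_col_zero {p : Poly2 K} {A B : GL (Fin 2) K} {s₁ s₂ : OnePoint K}
    (hA : A • (∞ : OnePoint K) = s₁) (hB : B • (∞ : OnePoint K) = s₂) (hs : OnCurve p s₁ s₂) :
    biHomEval p (A 1 0, A 0 0) (B 1 0, B 0 0) = 0 := by
  obtain ⟨c, -, h1, h2⟩ := exists_mul_homCoord A s₁ hA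
  obtain ⟨d, -, h3, h4⟩ := exists_mul_homCoord B s₂ hB
  rw [h1, h2, h3, h4, biHomEval_mul]
  exact mul_eq_zero_of_right _ hs

/-- A formal branch of the curve at a given point. -/
theorem exists_powerSeries_root [IsAlgClosed K] [CharZero K] {p : Poly2 K} (hp : Irreducible p)
    (hpy : 0 < p.degreeOf 1) (A B : GL (Fin 2) K)
    (h : biHomEval p (A 1 0, A 0 0) (B 1 0, B 0 0) = 0) :
    ∃ (N : ℕ) (_ : N ≠ 0) (w : K⟦X⟧), PowerSeries.constantCoeff w = 0 ∧
      biHomEval p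
        (PowerSeries.C (A 1 0) + PowerSeries.C (A 1 1) * PowerSeries.X ^ N,
          PowerSeries.C (A 0 0) + PowerSeries.C (A 0 1) * PowerSeries.X ^ N)
        (PowerSeries.C (B 1 0) + PowerSeries.C (B 1 1) * w,
          PowerSeries.C (B 0 0) + PowerSeries.C (B 0 1) * w) = 0 := by
  let l : K → Polynomial K⟦X⟧ := fun c => Polynomial.C (PowerSeries.C c)
  have hl : ∀ c, algebraMap K (Polynomial K⟦X⟧) c = l c := fun c => rfl
  -- The equation of the curve in local parameters, the first being the power series variable and
  -- the second the unknown. Its reduction `G` is the restriction to the vertical line through the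
  -- point: `G` vanishes at `0` and is not identically zero, so its trailing degree is the
  -- multiplicity required by `newton_puiseux`.
  set F : Polynomial K⟦X⟧ := biHomEval p
    (l (A 1 0) + l (A 1 1) * Polynomial.C PowerSeries.X,
      l (A 0 0) + l (A 0 1) * Polynomial.C PowerSeries.X)
    (l (B 1 0) + l (B 1 1) * Polynomial.X, l (B 0 0) + l (B 0 1) * Polynomial.X) with hF
  set G := F.map PowerSeries.constantCoeff with hG
  have hGeq : G = biHomEval p (Polynomial.C (A 1 0), Polynomial.C (A 0 0))
      (Polynomial.C (B 1 0) + Polynomial.C (B 1 1) * Polynomial.X,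
        Polynomial.C (B 0 0) + Polynomial.C (B 0 1) * Polynomial.X) := by
    rw [hG, ← Polynomial.coe_mapRingHom, hF, map_biHomEval]
    · simp [l]
    · intro c; simp [hl, l]
  have hG0 : G.coeff 0 = 0 := by
    rw [Polynomial.coeff_zero_eq_eval_zero, hGeq, ← Polynomial.coe_evalRingHom, map_biHomEval]
    · simpa using h
    · intro c; simp
  have hx : (xSer K).order < 0 := by rw [order_xSer]; norm_num
  have hx0 : xSer K ≠ 0 := by intro h; rw [h] at hx; simp at hx
  have hGne : G ≠ 0 := by
    intro hG'
    have h1 := congrArg (Polynomial.aeval (xSer K)⁻¹ : Polynomial K →ₐ[K] _).toRingHom hGeq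
    rw [hG', map_zero, map_biHomEval _ (fun c => by simp)] at h1
    have h2 := biHomEval_ne_zero (L := HahnSeries ℚ K) hp hpy (col_zero_ne_zero A)
      (y := (algebraMap K _ (B 1 0) + algebraMap K _ (B 1 1) * (xSer K)⁻¹,
        algebraMap K _ (B 0 0) + algebraMap K _ (B 0 1) * (xSer K)⁻¹))
      (denom_inv_ne_zero B hx) (by
        dsimp only
        rw [← moebius_eq_div_inv B hx0]; exact transcendental_moebius B hx)
    apply h2
    rw [h1]
    simp
  obtain ⟨N, hN, w, hw, hroot⟩ := newton_puiseux G.natTrailingDegree F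
    (Nat.pos_of_ne_zero fun h0 => by
      have := Polynomial.trailingCoeff_nonzero_iff_nonzero.mpr hGne
      rw [Polynomial.trailingCoeff, h0] at this
      exact this hG0)
    (fun i hi => by
      rw [← Polynomial.coeff_map]
      exact Polynomial.coeff_eq_zero_of_lt_natTrailingDegree hi)
    (by
      rw [← Polynomial.coeff_map]
      exact Polynomial.trailingCoeff_nonzero_iff_nonzero.mpr hGne)
  refine ⟨N, hN, w, hw, ?_⟩
  rw [← Polynomial.coe_mapRingHom, ← Polynomial.coe_evalRingHom, ← RingHom.comp_apply, hF,
    map_biHomEval] at hroot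
  · simpa [l, PowerSeries.expand_C] using hroot
  · intro c
    simp [hl, l, PowerSeries.expand_C]

/-- The root `w` is the second local parameter as a series in the first; with `x ^ (-1 / N)` for the
series variable, `φ` is the inverse of `w`. -/
theorem exists_branch [IsAlgClosed K] [CharZero K] {p : Poly2 K} (hp : Irreducible p)
    (hpx : 0 < p.degreeOf 0) (hpy : 0 < p.degreeOf 1) {s₁ s₂ : OnePoint K}
    (hs : OnCurve p s₁ s₂) (A B : GL (Fin 2) K) (hA : A • s₁ = ∞) (hB : B • s₂ = ∞) :
    ∃ φ : HahnSeries ℚ K, IsBranch (transPoly A B p) φ := by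
  obtain ⟨N, hN, w, hw, hroot⟩ := exists_powerSeries_root hp hpy A⁻¹ B⁻¹
    (biHom_col_zero (eq_inv_smul_iff.mpr hA).symm (eq_inv_smul_iff.mpr hB).symm hs)
  obtain ⟨θ, hC, hX, hsupp, hord⟩ := exists_substRoot K N hN
  have hN' : (N : ℚ) ≠ 0 := by exact_mod_cast hN
  have hx : (xSer K).order < 0 := by rw [order_xSer]; norm_num
  have hx0 : xSer K ≠ 0 := by intro h; rw [h] at hx; simp at hx
  have hXN : θ (PowerSeries.X ^ N) = (xSer K)⁻¹ := by
    rw [map_pow, hX, HahnSeries.single_pow, xSer_inv]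
    simp [hN']
  have hroot' := congrArg θ hroot
  rw [map_biHomEval θ hC, map_zero] at hroot'
  simp only [map_add, map_mul, hC, hXN] at hroot'
  -- If `w = 0`, the curve would contain the whole horizontal line through the point.
  have hw0 : w ≠ 0 := by
    rintro rfl
    rw [map_zero, mul_zero, mul_zero, add_zero, add_zero] at hroot'
    refine biHomEval_ne_zero' (L := HahnSeries ℚ K) hp hpx (col_zero_ne_zero B⁻¹)
      (denom_inv_ne_zero A⁻¹ hx) ?_ hroot'
    dsimp only
    rw [← moebius_eq_div_inv A⁻¹ hx0]
    exact transcendental_moebius A⁻¹ hx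
  set k := w.order.toNat with hk
  set u := PowerSeries.divXPowOrder w with hu
  have hku : PowerSeries.X ^ k * u = w := PowerSeries.X_pow_order_mul_divXPowOrder
  have huc : PowerSeries.constantCoeff u ≠ 0 :=
    fun h => hw0 (PowerSeries.constantCoeff_divXPowOrder_eq_zero_iff.mp h)
  have hk0 : k ≠ 0 := by
    intro h
    rw [← hku, h, pow_zero, one_mul] at hw
    exact huc hw
  have huu : θ u⁻¹ * θ u = 1 := by rw [← map_mul, PowerSeries.inv_mul_cancel u huc, map_one]
  -- With `w = X ^ k * u`, the inverse is written out so that its exponents visibly have the common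
  -- denominator `N`.
  set φ := HahnSeries.single (-(k / N : ℚ)) (1 : K) * θ u⁻¹ with hφ
  have hθw : θ w = φ⁻¹ := by
    rw [eq_comm, inv_eq_iff_eq_inv, eq_comm]
    refine inv_eq_of_mul_eq_one_left ?_
    rw [← hku, map_mul, map_pow, hX, HahnSeries.single_pow, hφ]
    calc _ = (HahnSeries.single (-(k / N : ℚ)) (1 : K) *
          HahnSeries.single (k • (1 / N : ℚ)) ((1 : K) ^ k)) * (θ u⁻¹ * θ u) := by ring
      _ = 1 := by
        rw [huu, HahnSeries.single_mul_single]
        simp [div_eq_mul_inv]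
  have hinv : PowerSeries.constantCoeff u⁻¹ ≠ 0 := by
    rw [PowerSeries.constantCoeff_inv]; exact inv_ne_zero huc
  have hφo : φ.order = -(k / N : ℚ) := by
    rw [hφ, HahnSeries.order_mul (HahnSeries.single_ne_zero one_ne_zero)
      (left_ne_zero_of_mul_eq_one huu), HahnSeries.order_single one_ne_zero, hord _ hinv, add_zero]
  have hφneg : φ.order < 0 := by
    rw [hφo, neg_lt_zero]
    have : 0 < k := Nat.pos_of_ne_zero hk0
    have : 0 < N := Nat.pos_of_ne_zero hN
    positivity
  have hφ0 : φ ≠ 0 := by intro h; rw [h] at hφneg; simp at hφneg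
  refine ⟨φ, ⟨N, Nat.pos_of_ne_zero hN, fun a ha => ?_⟩, ?_, by simpa [degSer] using hφneg⟩
  · rw [HahnSeries.mem_support, hφ, HahnSeries.coeff_single_mul, one_mul] at ha
    obtain ⟨n, hn⟩ := hsupp _ _ ha
    refine ⟨n - k, ?_⟩
    have : a = n / N - k / N := by linear_combination hn
    rw [this]
    push_cast
    field_simp
  · rw [aeval_transPoly_eq_zero_iff A B p hx hφneg]
    rw [hθw, biHomEval_div p (denom_inv_ne_zero A⁻¹ hx) (denom_inv_ne_zero B⁻¹ hφneg)] at hroot'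
    have := (mul_eq_zero.mp hroot').resolve_left (mul_ne_zero
      (pow_ne_zero _ (denom_inv_ne_zero A⁻¹ hx)) (pow_ne_zero _ (denom_inv_ne_zero B⁻¹ hφneg)))
    rwa [moebius_eq_div_inv A⁻¹ hx0, moebius_eq_div_inv B⁻¹ hφ0]

end Branches

/-! ### Comparing degrees along a branch -/

section Degrees

variable {K : Type*} [Field K]

theorem degSer_sub_of_lt {u v : HahnSeries ℚ K} (hu : 0 < degSer u) (hv : degSer v < degSer u) :
    degSer (u - v) = degSer u := by
  simp only [degSer, neg_lt_neg_iff, Left.neg_pos_iff] at hu hv ⊢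
  rw [sub_eq_add_neg, (order_add_eq_left hu (by rwa [HahnSeries.order_neg])).2]

theorem degSer_sub_comm (u v : HahnSeries ℚ K) : degSer (u - v) = degSer (v - u) := by
  rw [← neg_sub, degSer, HahnSeries.order_neg, degSer]

theorem degSer_pos_of_sub {u v : HahnSeries ℚ K} (h : 0 < degSer (u - v)) :
    0 < degSer u ∨ 0 < degSer v := by
  by_contra! h'
  -- Adding `v` back to `u - v` cannot change its degree, so `u` would have positive degree.
  have h1 := degSer_sub_of_lt (v := -v) h (by
    rw [degSer, HahnSeries.order_neg]; exact h'.2.trans_lt h)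
  rw [sub_neg_eq_add, sub_add_cancel] at h1
  linarith [h'.1]

/-- If the degrees differed, the difference would have the larger one, which is positive. -/
theorem degSer_eq_of_sub {u v : HahnSeries ℚ K} (h : ¬ 0 < degSer (u - v))
    (hu : 0 < degSer u ∨ 0 < degSer v) : degSer u = degSer v := by
  rcases lt_trichotomy (degSer u) (degSer v) with h1 | h1 | h1
  · have hv : 0 < degSer v := hu.elim (fun h => h.trans h1) id
    rw [degSer_sub_comm, degSer_sub_of_lt hv h1] at h
    exact absurd hv h
  · exact h1
  · have hv : 0 < degSer u := hu.elim id (fun h => h.trans h1)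
    rw [degSer_sub_of_lt hv h1] at h
    exact absurd hv h

/-- Along a branch, `r` is the difference of two series whose degrees are those of `f` and `g`. -/
theorem evalRat_branch_eq_sub {K : Type*} [Field K] [DecidableEq K] {p : Poly2 K}
    (hp : Irreducible p) (hpx : 0 < p.degreeOf 0) {r : Rat2 K} (hr : InLocalRing p r)
    {f g : RatFunc K} (hfg : (f, g) ∈ sepSet r p) {s₁ s₂ : OnePoint K} {A B : GL (Fin 2) K}
    (hA : A • s₁ = ∞) (hB : B • s₂ = ∞) {φ : HahnSeries ℚ K}
    (hφ : IsBranch (transPoly A B p) φ) :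
    ∃ u v : HahnSeries ℚ K, evalRat (xSer K) φ (transRat A B r) = u - v ∧
      degSer u = mult s₁ f ∧ degSer v = mult s₂ g * degSer φ := by
  obtain ⟨-, hroot, hdeg⟩ := hφ
  have hx : (xSer K).order < 0 := by rw [order_xSer]; norm_num
  have hy : φ.order < 0 := by simpa [degSer] using hdeg
  have hA' : A⁻¹ • (∞ : OnePoint K) = s₁ := (eq_inv_smul_iff.mpr hA).symm
  have hB' : B⁻¹ • (∞ : OnePoint K) = s₂ := (eq_inv_smul_iff.mpr hB).symm
  rw [aeval_transPoly_eq_zero_iff A B p hx hy] at hroot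
  set a := moebius A⁻¹ (xSer K) with ha
  set b := moebius B⁻¹ φ with hb
  have hreg : ∀ {d : Poly2 K}, ¬ p ∣ d → MvPolynomial.aeval ![a, b] d ≠ 0 := fun hd =>
    aeval_ne_zero_of_not_dvd hp hpx (transcendental_moebius B⁻¹ hy) hroot hd
  obtain ⟨q, hq, hqr⟩ := hfg
  -- The value of `r + q p` at `(a, b)` is `r(a, b)`, since `p` vanishes there; uniqueness of values
  -- equates it with `f(a) - g(b)`.
  have h1 := (HasValue.of_den_ne_zero (hreg hr)).add
    ((HasValue.of_den_ne_zero (hreg hq)).mul (HasValue.of_poly a b p))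
  rw [hqr, hroot, mul_zero, add_zero] at h1
  have h2 := ((HasValue.of_xx a b).ratFuncEval f
    (order_aeval_moebius A⁻¹ s₁ hA' hx _ (RatFunc.denom_ne_zero f)).1).sub
    ((HasValue.of_yy a b).ratFuncEval g
      (order_aeval_moebius B⁻¹ s₂ hB' hy _ (RatFunc.denom_ne_zero g)).1)
  have h3 := ((HasValue.of_xx (xSer K) φ).moebius A⁻¹ (moebius_denom_ne_zero A⁻¹ hx).1).evalRat
    ((HasValue.of_yy (xSer K) φ).moebius B⁻¹ (moebius_denom_ne_zero B⁻¹ hy).1) r (hreg hr)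
  refine ⟨_, _, h3.evalRat_eq.trans (h1.unique h2), ?_, degSer_eval_moebius B⁻¹ s₂ hB' hdeg g⟩
  rw [degSer_eval_moebius A⁻¹ s₁ hA' (by rw [degSer_xSer]; norm_num) f, degSer_xSer, mul_one]

theorem exists_smul_eq_infty {K : Type*} [Field K] [DecidableEq K] (s : OnePoint K) :
    ∃ A : GL (Fin 2) K, A • s = ∞ := by
  cases s with
  | infty => exact ⟨1, one_smul _ _⟩
  | coe k =>
    refine ⟨Matrix.GeneralLinearGroup.mkOfDetNeZero !![0, 1; 1, -k] (by simp), ?_⟩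
    rw [smul_some_eq_ite, if_pos]
    simp [Matrix.GeneralLinearGroup.mkOfDetNeZero]

end Degrees

end SepCurve

/-! ### The theorem on poles and multiplicities -/

theorem mainTheorem3 {K : Type*} [Field K] [DecidableEq K] [IsAlgClosed K] [CharZero K]
    (p : Poly2 K) (hp : Irreducible p)
    (hpx : 0 < p.degreeOf 0) (hpy : 0 < p.degreeOf 1)
    (r : Rat2 K) (hr : InLocalRing p r)
    (f g : RatFunc K) (hfg : (f, g) ∈ sepSet r p)
    (s₁ s₂ : OnePoint K) (hs : OnCurve p s₁ s₂) :
    -- a pole of `r` has a coordinate that is a pole of `f` or `g`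
    (IsPoleOnCurve p r s₁ s₂ → IsPole s₁ f ∨ IsPole s₂ g) ∧
    -- after moving the point to `(∞, ∞)` there is a branch to read off the local behavior from
    (∀ A B : GL (Fin 2) K, A • s₁ = ∞ → B • s₂ = ∞ →
      ∃ φ : HahnSeries ℚ K, IsBranch (transPoly A B p) φ) ∧
    -- if exactly one coordinate is a pole, its multiplicity can be read off from any branch
    (∀ A B : GL (Fin 2) K, A • s₁ = ∞ → B • s₂ = ∞ →
      ∀ φ : HahnSeries ℚ K, IsBranch (transPoly A B p) φ →
        (IsPole s₁ f → ¬ IsPole s₂ g →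
          (mult s₁ f : ℚ) = degSer (evalRat (xSer K) φ (transRat A B r))) ∧
        (IsPole s₂ g → ¬ IsPole s₁ f →
          (mult s₂ g : ℚ) = degSer (evalRat (xSer K) φ (transRat A B r)) / degSer φ)) ∧
    -- at a point that is not a pole of `r`, poles propagate ...
    (¬ IsPoleOnCurve p r s₁ s₂ → (IsPole s₁ f ↔ IsPole s₂ g)) ∧
    -- ... with a ratio of multiplicities that can be read off from any branch
    (¬ IsPoleOnCurve p r s₁ s₂ → IsPole s₁ f → IsPole s₂ g →
      ∀ A B : GL (Fin 2) K, A • s₁ = ∞ → B • s₂ = ∞ →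
        ∀ φ : HahnSeries ℚ K, IsBranch (transPoly A B p) φ →
          (mult s₂ g : ℚ) = (mult s₁ f : ℚ) / degSer φ) := by
  have pole : ∀ (A B : GL (Fin 2) K), A • s₁ = ∞ → B • s₂ = ∞ → ∀ φ : HahnSeries ℚ K,
      IsBranch (transPoly A B p) φ → ¬ IsPoleOnCurve p r s₁ s₂ →
        ¬ 0 < degSer (evalRat (xSer K) φ (transRat A B r)) :=
    fun A B hA hB φ hφ hn h => hn ⟨A, B, hA, hB, φ, hφ, h⟩
  refine ⟨?_, fun A B => exists_branch hp hpx hpy hs A B, ?_, ?_, ?_⟩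
  · rintro ⟨A, B, hA, hB, φ, hφ, hpos⟩
    obtain ⟨u, v, huv, hu, hv⟩ := evalRat_branch_eq_sub hp hpx hr hfg hA hB hφ
    rw [huv] at hpos
    rcases degSer_pos_of_sub hpos with h | h
    · rw [hu] at h
      exact Or.inl (by exact_mod_cast h)
    · rw [hv] at h
      exact Or.inr (by exact_mod_cast pos_of_mul_pos_left h hφ.2.2.le)
  · intro A B hA hB φ hφ
    obtain ⟨u, v, huv, hu, hv⟩ := evalRat_branch_eq_sub hp hpx hr hfg hA hB hφ
    have hd := hφ.2.2
    refine ⟨fun h1 h2 => ?_, fun h1 h2 => ?_⟩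
    · have hu' : 0 < degSer u := by rw [hu]; exact_mod_cast h1
      have hm : (mult s₂ g : ℚ) ≤ 0 := by exact_mod_cast not_lt.mp h2
      have hv' : degSer v ≤ 0 := by rw [hv]; exact mul_nonpos_of_nonpos_of_nonneg hm hd.le
      rw [huv, degSer_sub_of_lt hu' (hv'.trans_lt hu'), hu]
    · have hm : (0 : ℚ) < mult s₂ g := by exact_mod_cast h1
      have hv' : 0 < degSer v := by rw [hv]; exact mul_pos hm hd
      have hu' : degSer u ≤ 0 := by rw [hu]; exact_mod_cast not_lt.mp h2
      rw [huv, degSer_sub_comm, degSer_sub_of_lt hv' (hu'.trans_lt hv'), hv,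
        mul_div_cancel_right₀ _ hd.ne']
  · intro hn
    -- The equivalence mentions no branch, so one must be produced to compare `f` with `g`.
    obtain ⟨A, hA⟩ := exists_smul_eq_infty s₁
    obtain ⟨B, hB⟩ := exists_smul_eq_infty s₂
    obtain ⟨φ, hφ⟩ := exists_branch hp hpx hpy hs A B hA hB
    obtain ⟨u, v, huv, hu, hv⟩ := evalRat_branch_eq_sub hp hpx hr hfg hA hB hφ
    have hle := pole A B hA hB φ hφ hn
    rw [huv] at hle
    have hu' : IsPole s₁ f ↔ 0 < degSer u := by rw [hu, IsPole]; exact_mod_cast Iff.rfl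
    have hv' : IsPole s₂ g ↔ 0 < degSer v := by
      rw [hv, mul_pos_iff_of_pos_right hφ.2.2, IsPole]; exact_mod_cast Iff.rfl
    rw [hu', hv']
    exact ⟨fun h => degSer_eq_of_sub hle (Or.inl h) ▸ h,
      fun h => (degSer_eq_of_sub hle (Or.inr h)).symm ▸ h⟩
  · intro hn h1 _ A B hA hB φ hφ
    obtain ⟨u, v, huv, hu, hv⟩ := evalRat_branch_eq_sub hp hpx hr hfg hA hB hφ
    have hle := pole A B hA hB φ hφ hn
    rw [huv] at hle
    have hu' : 0 < degSer u := by rw [hu]; exact_mod_cast h1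
    rw [eq_div_iff hφ.2.2.ne', ← hv, ← hu, degSer_eq_of_sub hle (Or.inl hu')]
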